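/- Let $\mathcal{M}=(\mathcal{S},\mathcal{A},\mathcal{R},p)$ be a finite Markov decision process with real rewards and let $\mathcal{O}$ be a finite set of options; an option $o$ has a policy $\pi(\cdot\mid s,o)$ and termination probabilities $\beta(s,o)\in[0,1]$, and may be initiated in every state. An execution of $o$ from $s$ repeatedly draws an action from $\pi(\cdot\mid\cdot,o)$ and a next state and reward from $p$, and on each arrival in a state $s'$ terminates with probability $\beta(s',o)$. Let $\hat p(s',r,l\mid s,o)$ be the probability that an execution of $o$ from $s$ terminates in $s'$ after exactly $l\ge 1$ steps with cumulative reward $r$. Assume that the execution time of every option from every state is almost surely finite and has finite expectation, and let $$m^p(x\mid s,o)=\sum_{r,l}\hat p(x,r,l\mid s,o),\qquad m^r(s,o)=\sum_{s',r,l}\hat p(s',r,l\mid s,o)\,r,\qquad m^l(s,o)=\sum_{s',r,l}\hat p(s',r,l\mid s,o)\,l .$$ Let $S_t,O_t,A_t,R_{t+1},S_{t+1},\dots$ ($t\ge 0$) be a stream of experience on a probability space with a filtration $(\mathcal{F}_t)$: $S_t,O_t$ are $\mathcal{F}_t$-measurable, $A_t,R_{t+1}$ are $\mathcal{F}_{t+1}$-measurable,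 and given $\mathcal{F}_t$ the triple $(A_t,S_{t+1},R_{t+1})$ equals $(a,s',r)$ with probability $\pi(a\mid S_t,O_t)\,p(s',r\mid S_t,a)$; the way in which the executed options $O_t$ are selected is otherwise arbitrary. Let $\rho_t(o)=\pi(A_t\mid S_t,o)/\pi(A_t\mid S_t,O_t)$. For each state-option pair let $\alpha_t(s,o)$, $t\ge0$, be $\mathcal{F}_t$-measurable step sizes such that, almost surely, for all $s,o$: $0\le\alpha_t(s,o)\le1$, $\sum_t\alpha_t(s,o)=\infty$, $\sum_t\alpha_t(s,o)^2<\infty$, and $\alpha_t(s,o)=0$ unless $s=S_t$ (hence every state-option pair is updated infinitely often). Assume also that, almost surely, whenever $\alpha_t(S_t,o)\ne0$, every action $a$ with $\pi(a\mid S_t,o)>0$ satisfies $\pi(a\mid S_t,O_t)>0$. Starting from arbitrary initial estimates $M^p_0,M^r_0,M^l_0$, for every $t$, every $o\in\mathcal{O}$ and every $x\in\mathcal{S}$ update $$M^p_{t+1}(x\mid S_t,o)=M^p_t(x\mid S_t,o)+\alpha_t(S_t,o)\rho_t(o)\Big(\beta(S_{t+1},o)\mathbb{I}(S_{t+1}=x)+(1-\beta(S_{t+1},o))M^p_t(x\mid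 S_{t+1},o)-M^p_t(x\mid S_t,o)\Big),$$ $$M^r_{t+1}(S_t,o)=M^r_t(S_t,o)+\alpha_t(S_t,o)\rho_t(o)\Big(R_{t+1}+(1-\beta(S_{t+1},o))M^r_t(S_{t+1},o)-M^r_t(S_t,o)\Big),$$ $$M^l_{t+1}(S_t,o)=M^l_t(S_t,o)+\alpha_t(S_t,o)\rho_t(o)\Big(1+(1-\beta(S_{t+1},o))M^l_t(S_{t+1},o)-M^l_t(S_t,o)\Big),$$ and leave all other entries unchanged. Then, almost surely, for all $s,x\in\mathcal{S}$ and $o\in\mathcal{O}$, as $t\to\infty$, $$M^p_t(x\mid s,o)\to m^p(x\mid s,o),\qquad M^r_t(s,o)\to m^r(s,o),\qquad M^l_t(s,o)\to m^l(s,o).$$ -/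

import Mathlib

open MeasureTheory Filter Topology

noncomputable section

/-- A finite Markov decision process with state type `S`, action type `A` (both taken finite),
a finite set of real rewards, and dynamics `p s' r s a = p(s', r | s, a)`. -/
structure FiniteMDP (S A : Type*) [Fintype S] where
  /-- the set of rewards -/
  rewards : Finset ℝ
  /-- `p s' r s a` is the probability of next state `s'` and reward `r` after action `a` in `s` -/
  p : S → rewards → S → A → ℝ
  p_nonneg : ∀ s' r s a, 0 ≤ p s' r s a
  p_sum : ∀ s a, ∑ s', ∑ r, p s' r s a = 1

/-- An option (initiable in every state): a stationary stochastic policy `policy a s = π(a | s, o)`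
and a termination probability `termination s = β(s, o)`. -/
structure MDPOption (S A : Type*) [Fintype A] where
  /-- `policy a s` is the probability of choosing action `a` in state `s` -/
  policy : A → S → ℝ
  policy_nonneg : ∀ a s, 0 ≤ policy a s
  policy_sum : ∀ s, ∑ a, policy a s = 1
  /-- the probability that the option terminates on arrival in a state -/
  termination : S → ℝ
  termination_nonneg : ∀ s, 0 ≤ termination s
  termination_le_one : ∀ s, termination s ≤ 1

section OptionModel

variable {S A : Type*} [Fintype S] [Fintype A]

/-- The probability that an execution of the option `o` started in `x 0` passes through the states
`x 0, x 1, …, x (n + 1)` with actions `a 0, …, a n` and rewards `u 0, …, u n`, does not terminate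
in `x 1, …, x n`, and terminates in `x (n + 1)`. -/
def executionProb (M : FiniteMDP S A) (o : MDPOption S A) (n : ℕ)
    (x : Fin (n + 2) → S) (a : Fin (n + 1) → A) (u : Fin (n + 1) → M.rewards) : ℝ :=
  (∏ i : Fin (n + 1), o.policy (a i) (x i.castSucc) * M.p (x i.succ) (u i) (x i.castSucc) (a i)) *
    (∏ i : Fin n, (1 - o.termination (x i.succ.castSucc))) * o.termination (x (Fin.last (n + 1)))

open Classical in
/-- The option transition probability `p̂(s', r, l | s, o)`: the probability that the option `o`
started in `s` terminates in `s'` after exactly `l` steps with cumulative reward `r`. -/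
def optionTransitionProb (M : FiniteMDP S A) (o : MDPOption S A) (s s' : S) (r : ℝ) : ℕ → ℝ
  | 0 => 0
  | n + 1 =>
    ∑ x : Fin (n + 2) → S, ∑ a : Fin (n + 1) → A, ∑ u : Fin (n + 1) → M.rewards,
      if x 0 = s ∧ x (Fin.last (n + 1)) = s' ∧ ∑ i, (u i : ℝ) = r then
        executionProb M o n x a u
      else 0

/-- The execution time of the option `o` started in `s` has finite expectation: it is almost surely
finite (the option transition probabilities sum to one) and the series of its mean converges. -/
def FiniteExpectedDuration (M : FiniteMDP S A) (o : MDPOption S A) (s : S) : Prop :=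
  HasSum (fun z : S × ℝ × ℕ => optionTransitionProb M o s z.1 z.2.1 z.2.2) 1 ∧
    Summable fun z : S × ℝ × ℕ => optionTransitionProb M o s z.1 z.2.1 z.2.2 * (z.2.2 : ℝ)

/-- The dynamics part `m^p(s' | s, o)`: the probability that `o` started in `s` terminates
in `s'`. -/
def dynamicsModel (M : FiniteMDP S A) (o : MDPOption S A) (s' s : S) : ℝ :=
  ∑' z : ℝ × ℕ, optionTransitionProb M o s s' z.1 z.2

/-- The reward part `m^r(s, o)`: the expected cumulative reward of `o` started in `s`. -/
def rewardModel (M : FiniteMDP S A) (o : MDPOption S A) (s : S) : ℝ :=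
  ∑' z : S × ℝ × ℕ, optionTransitionProb M o s z.1 z.2.1 z.2.2 * z.2.1

/-- The duration part `m^l(s, o)`: the expected duration of `o` started in `s`. -/
def durationModel (M : FiniteMDP S A) (o : MDPOption S A) (s : S) : ℝ :=
  ∑' z : S × ℝ × ℕ, optionTransitionProb M o s z.1 z.2.1 z.2.2 * (z.2.2 : ℝ)

lemma executionProb_nonneg (M : FiniteMDP S A) (o : MDPOption S A) (n : ℕ)
    (x : Fin (n + 2) → S) (a : Fin (n + 1) → A) (u : Fin (n + 1) → M.rewards) :
    0 ≤ executionProb M o n x a u :=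
  mul_nonneg (mul_nonneg
    (Finset.prod_nonneg fun _ _ => mul_nonneg (o.policy_nonneg _ _) (M.p_nonneg _ _ _ _))
    (Finset.prod_nonneg fun _ _ => sub_nonneg.2 (o.termination_le_one _)))
    (o.termination_nonneg _)

lemma optionTransitionProb_nonneg (M : FiniteMDP S A) (o : MDPOption S A) (s s' : S) (r : ℝ)
    (l : ℕ) : 0 ≤ optionTransitionProb M o s s' r l := by
  cases l with
  | zero => simp [optionTransitionProb]
  | succ n =>
    simp only [optionTransitionProb]
    refine Finset.sum_nonneg fun x _ => Finset.sum_nonneg fun a _ => Finset.sum_nonneg fun u _ => ?_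
    split_ifs
    · exact executionProb_nonneg M o n x a u
    · exact le_rfl

/-- The series that defines the reward part converges absolutely. -/
lemma summable_rewardModel (M : FiniteMDP S A) (o : MDPOption S A) (s : S)
    (h : FiniteExpectedDuration M o s) :
    Summable fun z : S × ℝ × ℕ => optionTransitionProb M o s z.1 z.2.1 z.2.2 * z.2.1 := by
  set C : ℝ := ∑ r ∈ M.rewards, |r| with hC
  have key : ∀ s' r l, optionTransitionProb M o s s' r l ≠ 0 → |r| ≤ C * (l : ℝ) := by
    intro s' r l hne
    cases l with
    | zero => simp [optionTransitionProb] at hne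
    | succ n =>
      simp only [optionTransitionProb] at hne
      obtain ⟨x, -, hx⟩ := Finset.exists_ne_zero_of_sum_ne_zero hne
      obtain ⟨a, -, ha⟩ := Finset.exists_ne_zero_of_sum_ne_zero hx
      obtain ⟨u, -, hu⟩ := Finset.exists_ne_zero_of_sum_ne_zero ha
      have hr : ∑ i, (u i : ℝ) = r := by
        by_contra hcon
        exact hu (if_neg fun hh => hcon hh.2.2)
      rw [← hr]
      calc |∑ i, (u i : ℝ)| ≤ ∑ i, |(u i : ℝ)| := Finset.abs_sum_le_sum_abs _ _
        _ ≤ ∑ _i : Fin (n + 1), C := Finset.sum_le_sum fun i _ =>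
            Finset.single_le_sum (f := fun r : ℝ => |r|) (fun r _ => abs_nonneg r) (u i).2
        _ = C * ((n + 1 : ℕ) : ℝ) := by simp [mul_comm]
  refine Summable.of_norm_bounded (h.2.mul_left C) fun z => ?_
  have h0 := optionTransitionProb_nonneg M o s z.1 z.2.1 z.2.2
  rw [Real.norm_eq_abs, abs_mul, abs_of_nonneg h0]
  by_cases hz : optionTransitionProb M o s z.1 z.2.1 z.2.2 = 0
  · simp [hz]
  · have := mul_le_mul_of_nonneg_left (key _ _ _ hz) h0
    linarith

end OptionModel

section Experience

variable {S A O Ω : Type*} [Fintype S] [Fintype A] [Fintype O] [MeasurableSpace Ω]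

/-- A stream of experience `S_t, O_t, A_t, R_{t+1}, S_{t+1}, …` generated by executing options:
the state `S_t` and the executed option `O_t` are known at time `t`, and given everything known at
time `t`, the action `A_t` is drawn from `π(· | S_t, O_t)` and then the next state and reward from
`p(·, · | S_t, A_t)`.  How the executed option is selected (when the current one ends and which one
comes next) is left arbitrary, as long as it does not look into the future. -/
structure IsExperience (P : Measure Ω) (ℱ : Filtration ℕ (inferInstance : MeasurableSpace Ω))
    (M : FiniteMDP S A) (opts : O → MDPOption S A)
    (St : ℕ → Ω → S) (Ot : ℕ → Ω → O) (At : ℕ → Ω → A) (Rt : ℕ → Ω → ℝ) : Prop where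
  measurable_state : ∀ t, Measurable[ℱ t, ⊤] (St t)
  measurable_option : ∀ t, Measurable[ℱ t, ⊤] (Ot t)
  measurable_action : ∀ t, Measurable[ℱ (t + 1), ⊤] (At t)
  measurable_reward : ∀ t, Measurable[ℱ (t + 1)] (Rt (t + 1))
  transition : ∀ (t : ℕ) (a : A) (s' : S) (r : M.rewards),
    P[Set.indicator {ω | At t ω = a ∧ St (t + 1) ω = s' ∧ Rt (t + 1) ω = (r : ℝ)}
        (fun _ => (1 : ℝ)) | ℱ t]
      =ᵐ[P] fun ω => (opts (Ot t ω)).policy a (St t ω) * M.p s' r (St t ω) a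

end Experience

section Algorithm

variable {S A O : Type*} [Fintype A]

/-- The importance sampling ratio `π(a | s, o) / π(a | s, o')`, with `o'` the executed option. -/
def importanceRatio (opts : O → MDPOption S A) (a : A) (s : S) (o o' : O) : ℝ :=
  (opts o).policy a s / (opts o').policy a s

open Classical in
/-- The estimates `M^p_t(x | s, o)` along a trajectory `st, ot, act` of states, executed options and
actions, with step sizes `α t s o` and initial estimate `M₀`: at time `t` the entries
`(x | S_t, o)`, for all `x` and `o`, are updated and the other entries stay the same. -/
def dynamicsEstimate (opts : O → MDPOption S A) (α : ℕ → S → O → ℝ)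
    (st : ℕ → S) (ot : ℕ → O) (act : ℕ → A) (M₀ : S → S → O → ℝ) : ℕ → S → S → O → ℝ
  | 0 => M₀
  | t + 1 => fun x s o =>
    let m := dynamicsEstimate opts α st ot act M₀ t
    let s' := st (t + 1)
    let β := (opts o).termination s'
    if s = st t then
      m x s o + α t s o * importanceRatio opts (act t) s o (ot t) *
        (β * (if s' = x then 1 else 0) + (1 - β) * m x s' o - m x s o)
    else m x s o

open Classical in
/-- The estimates `M_t(s, o)` of the expected total of a per-step signal `c` (`c (t + 1)` is received
in the step from time `t` to time `t + 1`) accumulated until termination. -/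
def cumulantEstimate (opts : O → MDPOption S A) (α : ℕ → S → O → ℝ)
    (st : ℕ → S) (ot : ℕ → O) (act : ℕ → A) (c : ℕ → ℝ) (M₀ : S → O → ℝ) : ℕ → S → O → ℝ
  | 0 => M₀
  | t + 1 => fun s o =>
    let m := cumulantEstimate opts α st ot act c M₀ t
    let s' := st (t + 1)
    let β := (opts o).termination s'
    if s = st t then
      m s o + α t s o * importanceRatio opts (act t) s o (ot t) *
        (c (t + 1) + (1 - β) * m s' o - m s o)
    else m s o

/-- The estimates `M^r_t(s, o)`: the signal is the reward. -/
def rewardEstimate (opts : O → MDPOption S A) (α : ℕ → S → O → ℝ)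
    (st : ℕ → S) (ot : ℕ → O) (act : ℕ → A) (rew : ℕ → ℝ) (M₀ : S → O → ℝ) : ℕ → S → O → ℝ :=
  cumulantEstimate opts α st ot act rew M₀

/-- The estimates `M^l_t(s, o)`: the signal is one at every step. -/
def durationEstimate (opts : O → MDPOption S A) (α : ℕ → S → O → ℝ)
    (st : ℕ → S) (ot : ℕ → O) (act : ℕ → A) (M₀ : S → O → ℝ) : ℕ → S → O → ℝ :=
  cumulantEstimate opts α st ot act (fun _ => 1) M₀

end Algorithm

end
/-!
Conditioning on the first step of an option shows that each of the three models solves a Bellman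
equation, and the estimates are temporal difference iterates for it: importance sampling turns the
conditional mean of an update into the Bellman residual of the updated option. The duration model is
the weight that makes the Bellman operator a contraction, since it drops by one in each step. In
the coordinates in which errors are divided by it, the iterates are averages of contracting targets
and of noise whose size is proportional to the current error. Divided by its running maximum the
noise is bounded, so its martingale transform by the step sizes converges almost surely, and the
deterministic argument for contracting averages with vanishing noise applies.
-/

section Averaging

variable {E : Type*} [NormedAddCommGroup E] [NormedSpace ℝ E]

theorem norm_sum_range_succ_smul_le {B : ℕ → ℝ} {a : ℕ → E} {δ : ℝ} (hB : Monotone B)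
    (hB₀ : 0 ≤ B 0) (ha : ∀ n, ‖∑ k ∈ Finset.range n, a k‖ ≤ δ) (n : ℕ) :
    ‖∑ k ∈ Finset.range (n + 1), B k • a k‖ ≤ 2 * δ * B n := by
  have hδ : 0 ≤ δ := (norm_nonneg _).trans (ha 0)
  rw [Finset.sum_range_by_parts, Nat.add_sub_cancel]
  calc ‖B n • ∑ k ∈ Finset.range (n + 1), a k
        - ∑ k ∈ Finset.range n, (B (k + 1) - B k) • ∑ i ∈ Finset.range (k + 1), a i‖
      ≤ B n * δ + ∑ k ∈ Finset.range n, (B (k + 1) - B k) * δ := by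
        refine (norm_sub_le _ _).trans (add_le_add ?_ (norm_sum_le_of_le _ fun k _ => ?_))
        · rw [norm_smul, Real.norm_of_nonneg (hB₀.trans (hB n.zero_le))]
          exact mul_le_mul_of_nonneg_left (ha _) (hB₀.trans (hB n.zero_le))
        · have hk : 0 ≤ B (k + 1) - B k := sub_nonneg.2 (hB k.le_succ)
          rw [norm_smul, Real.norm_of_nonneg hk]
          exact mul_le_mul_of_nonneg_left (ha _) hk
    _ = 2 * δ * B n - δ * B 0 := by rw [← Finset.sum_mul, Finset.sum_range_sub]; ring
    _ ≤ 2 * δ * B n := sub_le_self _ (mul_nonneg hδ hB₀)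

theorem exists_tendsto_sum_range_smul [CompleteSpace E] {B : ℕ → ℝ} {a : ℕ → E} {l : E}
    (hB : Monotone B) (hB_bdd : BddAbove (Set.range B))
    (ha : Tendsto (fun n => ∑ k ∈ Finset.range n, a k) atTop (𝓝 l)) :
    ∃ l', Tendsto (fun n => ∑ k ∈ Finset.range n, B k • a k) atTop (𝓝 l') := by
  obtain ⟨b, hb⟩ : ∃ b, Tendsto B atTop (𝓝 b) := ⟨_, tendsto_atTop_ciSup hB hB_bdd⟩
  obtain ⟨K, hK⟩ := (Metric.isBounded_range_of_tendsto _ ha).exists_norm_le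
  have hcauchy : CauchySeq fun n => ∑ i ∈ Finset.range n, (B i - b) • a i :=
    Monotone.cauchySeq_series_mul_of_tendsto_zero_of_bounded (b := K)
      (fun i j hij => sub_le_sub_right (hB hij) b)
      (by simpa using hb.sub_const b) (fun n => hK _ ⟨n, rfl⟩)
  obtain ⟨l', hl'⟩ := cauchySeq_tendsto_of_complete hcauchy
  refine ⟨l' + b • l, (hl'.add (ha.const_smul b)).congr fun n => ?_⟩
  simp only [Finset.smul_sum, ← Finset.sum_add_distrib, ← add_smul, sub_add_cancel]

theorem norm_one_sub_smul_add_smul_le {a c : ℝ} {x y : E} (ha : a ∈ Set.Icc (0 : ℝ) 1)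
    (hx : ‖x‖ ≤ c) (hy : ‖y‖ ≤ c) : ‖(1 - a) • x + a • y‖ ≤ c := by
  rw [← mem_closedBall_zero_iff] at hx hy ⊢
  exact convex_closedBall 0 c hx hy (sub_nonneg.2 ha.2) ha.1 (sub_add_cancel 1 a)

theorem tendsto_prod_one_sub_zero {α : ℕ → ℝ} (hα : ∀ t, α t ≤ 1)
    (hsum : Tendsto (fun n => ∑ t ∈ Finset.range n, α t) atTop atTop) :
    Tendsto (fun n => ∏ t ∈ Finset.range n, (1 - α t)) atTop (𝓝 0) := by
  refine squeeze_zero (fun n => Finset.prod_nonneg fun t _ => sub_nonneg.2 (hα t))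
    (fun n => ?_) (Real.tendsto_exp_neg_atTop_nhds_zero.comp hsum)
  calc ∏ t ∈ Finset.range n, (1 - α t) ≤ ∏ t ∈ Finset.range n, Real.exp (-α t) :=
        Finset.prod_le_prod (fun t _ => sub_nonneg.2 (hα t))
          fun t _ => Real.one_sub_le_exp_neg _
    _ = Real.exp (-∑ t ∈ Finset.range n, α t) := by
        rw [← Real.exp_sum, Finset.sum_neg_distrib]

theorem tendsto_sum_range_add_atTop {α : ℕ → ℝ} (hα : ∀ t, 0 ≤ α t)
    (hsum : Tendsto (fun n => ∑ t ∈ Finset.range n, α t) atTop atTop) (T : ℕ) :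
    Tendsto (fun n => ∑ t ∈ Finset.range n, α (t + T)) atTop atTop := by
  rw [← not_summable_iff_tendsto_nat_atTop_of_nonneg hα] at hsum
  rwa [← not_summable_iff_tendsto_nat_atTop_of_nonneg fun t => hα (t + T),
    summable_nat_add_iff (f := α)]

theorem norm_le_add_prod_mul_of_averaging {u g : ℕ → E} {α : ℕ → ℝ} {c : ℝ}
    (hα : ∀ t, α t ∈ Set.Icc (0 : ℝ) 1) (hu : ∀ t, u (t + 1) = (1 - α t) • u t + α t • g t)
    (hg : ∀ t, ‖g t‖ ≤ c) (n : ℕ) :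
    ‖u n‖ ≤ c + (∏ t ∈ Finset.range n, (1 - α t)) * ‖u 0‖ := by
  induction n with
  | zero => simpa using (norm_nonneg _).trans (hg 0)
  | succ n ih =>
    have hα' : 0 ≤ 1 - α n := sub_nonneg.2 (hα n).2
    calc ‖u (n + 1)‖ ≤ (1 - α n) * ‖u n‖ + α n * ‖g n‖ := by
          rw [hu]
          refine (norm_add_le _ _).trans_eq ?_
          rw [norm_smul, norm_smul, Real.norm_of_nonneg hα', Real.norm_of_nonneg (hα n).1]
      _ ≤ (1 - α n) * (c + (∏ t ∈ Finset.range n, (1 - α t)) * ‖u 0‖) + α n * c :=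
          add_le_add (mul_le_mul_of_nonneg_left ih hα')
            (mul_le_mul_of_nonneg_left (hg n) (hα n).1)
      _ = c + (∏ t ∈ Finset.range (n + 1), (1 - α t)) * ‖u 0‖ := by
          rw [Finset.prod_range_succ]; ring

theorem eventually_norm_le_add_of_averaging {u g : ℕ → E} {α : ℕ → ℝ} {c ε : ℝ}
    (hα : ∀ t, α t ∈ Set.Icc (0 : ℝ) 1)
    (hsum : Tendsto (fun n => ∑ t ∈ Finset.range n, α t) atTop atTop)
    (hu : ∀ t, u (t + 1) = (1 - α t) • u t + α t • g t)
    (hg : ∀ᶠ t in atTop, ‖g t‖ ≤ c) (hε : 0 < ε) :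
    ∀ᶠ t in atTop, ‖u t‖ ≤ c + ε := by
  obtain ⟨T, hT⟩ := eventually_atTop.1 hg
  have hbound : ∀ n, ‖u (n + T)‖ ≤ c + (∏ t ∈ Finset.range n, (1 - α (t + T))) * ‖u (0 + T)‖ :=
    norm_le_add_prod_mul_of_averaging (u := fun t => u (t + T)) (fun t => hα (t + T))
      (fun t => by rw [add_right_comm, hu]) fun t => hT _ (Nat.le_add_left T t)
  have hprod : Tendsto (fun n => (∏ t ∈ Finset.range n, (1 - α (t + T))) * ‖u (0 + T)‖)
      atTop (𝓝 0) := by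
    simpa only [zero_mul] using (tendsto_prod_one_sub_zero (fun t => (hα (t + T)).2)
      (tendsto_sum_range_add_atTop (fun t => (hα t).1) hsum T)).mul_const ‖u (0 + T)‖
  rw [← map_add_atTop_eq_nat T, eventually_map]
  filter_upwards [hprod.eventually_lt_const hε] with n hn
  exact (hbound n).trans (add_le_add_right hn.le c)

end Averaging

theorem tendsto_zero_of_eventually_norm_le_mul_add {ι E : Type*} [SeminormedAddCommGroup E]
    {l : Filter ι} {f : ι → E} {γ C : ℝ} (hγ : γ ∈ Set.Ico (0 : ℝ) 1)
    (hC : ∀ᶠ t in l, ‖f t‖ ≤ C)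
    (hstep : ∀ D, (∀ᶠ t in l, ‖f t‖ ≤ D) → ∀ ε > 0, ∀ᶠ t in l, ‖f t‖ ≤ γ * D + ε) :
    Tendsto f l (𝓝 0) := by
  have hpow : ∀ n : ℕ, ∀ ε > 0, ∀ᶠ t in l, ‖f t‖ ≤ γ ^ n * C + ε := by
    intro n
    induction n with
    | zero =>
      intro ε hε
      filter_upwards [hC] with t ht
      linarith
    | succ n ih =>
      intro ε hε
      filter_upwards [hstep _ (ih (ε / 2) (half_pos hε)) (ε / 2) (half_pos hε)] with t ht
      have hγε : γ * (ε / 2) ≤ ε / 2 := mul_le_of_le_one_left (half_pos hε).le hγ.2.le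
      rw [pow_succ']
      linarith
  refine Metric.tendsto_nhds.2 fun ε hε => ?_
  have hlim : Tendsto (fun n => γ ^ n * C) atTop (𝓝 0) := by
    simpa using (tendsto_pow_atTop_nhds_zero_of_lt_one hγ.1 hγ.2).mul_const C
  obtain ⟨n, hn⟩ := (hlim.eventually_lt_const (half_pos hε)).exists
  filter_upwards [hpow n (ε / 3) (by positivity)] with t ht
  rw [dist_zero_right]
  linarith

section NoisyContraction

variable {S E : Type*} [Fintype S] [NormedAddCommGroup E] [NormedSpace ℝ E]

/-- An asynchronous iteration `f` with step sizes `α` towards targets `h` that contract the sup norm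
by the factor `γ`. The noise is written as `B t • d t s`, where `B` is a running bound of the
iterates: it is only under control relative to the size of the iterates, which are not known to be
bounded beforehand. -/
structure IsNoisyContraction (γ : ℝ) (α : ℕ → S → ℝ) (f h d : ℕ → S → E) (B : ℕ → ℝ) : Prop where
  nonneg : 0 ≤ γ
  stepSize_mem : ∀ t s, α t s ∈ Set.Icc (0 : ℝ) 1
  step : ∀ t s, f (t + 1) s = (1 - α t s) • f t s + α t s • h t s + B t • d t s
  target_le : ∀ t s, ‖h t s‖ ≤ γ * ‖f t‖
  monotone : Monotone B
  norm_le : ∀ t, ‖f t‖ ≤ B t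
  succ_le : ∀ t, B (t + 1) ≤ max (B t) ‖f (t + 1)‖

/-- The total noise `∑ k < t, B k • d k s` of an iteration as in `IsNoisyContraction`; subtracting
it from the iterates leaves a noiseless averaging. -/
def accumulatedNoise (B : ℕ → ℝ) (d : ℕ → S → E) (t : ℕ) (s : S) : E :=
  ∑ k ∈ Finset.range t, B k • d k s

namespace IsNoisyContraction

variable {γ δ : ℝ} {α : ℕ → S → ℝ} {f h d : ℕ → S → E} {B : ℕ → ℝ}

theorem bound_nonneg (hf : IsNoisyContraction γ α f h d B) (t : ℕ) : 0 ≤ B t :=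
  (norm_nonneg _).trans (hf.norm_le t)

theorem norm_target_le (hf : IsNoisyContraction γ α f h d B) (t : ℕ) (s : S) :
    ‖h t s‖ ≤ γ * B t :=
  (hf.target_le t s).trans (mul_le_mul_of_nonneg_left (hf.norm_le t) hf.nonneg)

theorem shift (hf : IsNoisyContraction γ α f h d B) (T : ℕ) :
    IsNoisyContraction γ (fun t => α (T + t)) (fun t => f (T + t)) (fun t => h (T + t))
      (fun t => d (T + t)) fun t => B (T + t) where
  nonneg := hf.nonneg
  stepSize_mem _ := hf.stepSize_mem _
  step _ := hf.step _
  target_le _ := hf.target_le _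
  monotone _ _ hij := hf.monotone (Nat.add_le_add_left hij T)
  norm_le _ := hf.norm_le _
  succ_le _ := hf.succ_le _

theorem sub_accumulatedNoise_succ (hf : IsNoisyContraction γ α f h d B) (c : E) (t : ℕ) (s : S) :
    f (t + 1) s - (accumulatedNoise B d (t + 1) s - c)
      = (1 - α t s) • (f t s - (accumulatedNoise B d t s - c))
        + α t s • (h t s - (accumulatedNoise B d t s - c)) := by
  rw [hf.step, accumulatedNoise, Finset.sum_range_succ, ← accumulatedNoise]
  module

theorem norm_accumulatedNoise_succ_le (hf : IsNoisyContraction γ α f h d B)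
    (hd : ∀ n s, ‖∑ k ∈ Finset.range n, d k s‖ ≤ δ) (t : ℕ) (s : S) :
    ‖accumulatedNoise B d (t + 1) s‖ ≤ 2 * δ * B t :=
  norm_sum_range_succ_smul_le hf.monotone (hf.bound_nonneg 0) (fun n => hd n s) t

theorem norm_sub_accumulatedNoise_le (hf : IsNoisyContraction γ α f h d B)
    (hd : ∀ n s, ‖∑ k ∈ Finset.range n, d k s‖ ≤ δ) (t : ℕ) (s : S) :
    ‖f (t + 1) s - accumulatedNoise B d (t + 1) s‖ ≤ max (B 0) ((γ + 2 * δ) * B t) := by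
  have hδ : 0 ≤ δ := (norm_nonneg _).trans (hd 0 s)
  have hstep := hf.sub_accumulatedNoise_succ 0
  simp only [sub_zero] at hstep
  induction t with
  | zero =>
    have hzero : accumulatedNoise B d 0 s = 0 := Finset.sum_range_zero _
    rw [hstep, hzero, sub_zero, sub_zero]
    refine norm_one_sub_smul_add_smul_le (hf.stepSize_mem 0 s)
      (le_max_of_le_left ((norm_le_pi_norm (f 0) s).trans (hf.norm_le 0))) (le_max_of_le_right ?_)
    exact (hf.norm_target_le 0 s).trans
      (mul_le_mul_of_nonneg_right (by linarith) (hf.bound_nonneg 0))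
  | succ t ih =>
    have hB : B t ≤ B (t + 1) := hf.monotone t.le_succ
    rw [hstep]
    refine norm_one_sub_smul_add_smul_le (hf.stepSize_mem _ s)
      (ih.trans (max_le_max le_rfl ?_)) (le_max_of_le_right ?_)
    · exact mul_le_mul_of_nonneg_left hB (add_nonneg hf.nonneg (by linarith))
    · calc ‖h (t + 1) s - accumulatedNoise B d (t + 1) s‖ ≤ γ * B (t + 1) + 2 * δ * B t :=
            (norm_sub_le _ _).trans
              (add_le_add (hf.norm_target_le _ s) (hf.norm_accumulatedNoise_succ_le hd t s))
        _ ≤ γ * B (t + 1) + 2 * δ * B (t + 1) := by gcongr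
        _ = (γ + 2 * δ) * B (t + 1) := by ring

theorem le_div_of_norm_noise_le (hf : IsNoisyContraction γ α f h d B) (hδ₀ : 0 ≤ δ)
    (hδ : γ + 4 * δ ≤ 1) (hd : ∀ n s, ‖∑ k ∈ Finset.range n, d k s‖ ≤ δ) (t : ℕ) :
    B t ≤ B 0 / (1 - 2 * δ) := by
  have hpos : 0 < 1 - 2 * δ := by linarith [hf.nonneg]
  set D : ℝ := B 0 / (1 - 2 * δ)
  have hD₀ : 0 ≤ D := div_nonneg (hf.bound_nonneg 0) hpos.le
  have hD : B 0 + 2 * δ * D = D := by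
    have : D * (1 - 2 * δ) = B 0 := div_mul_cancel₀ _ hpos.ne'
    linarith
  induction t with
  | zero => linarith [mul_nonneg hδ₀ hD₀]
  | succ t ih =>
    refine (hf.succ_le t).trans (max_le ih ((pi_norm_le_iff_of_nonneg hD₀).2 fun s => ?_))
    have hnoise : 2 * δ * B t ≤ 2 * δ * D := by gcongr
    calc ‖f (t + 1) s‖
        ≤ ‖f (t + 1) s - accumulatedNoise B d (t + 1) s‖ + ‖accumulatedNoise B d (t + 1) s‖ :=
          norm_le_norm_sub_add _ _
      _ ≤ max (B 0) ((γ + 2 * δ) * B t) + 2 * δ * B t :=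
          add_le_add (hf.norm_sub_accumulatedNoise_le hd t s)
            (hf.norm_accumulatedNoise_succ_le hd t s)
      _ ≤ D := by
          rw [← max_add_add_right]
          refine max_le (by linarith) ?_
          linarith [mul_le_mul_of_nonneg_right hδ (hf.bound_nonneg t)]

theorem bddAbove_bound (hf : IsNoisyContraction γ α f h d B) (hγ : γ < 1)
    (hd : ∀ s, ∃ l, Tendsto (fun n => ∑ k ∈ Finset.range n, d k s) atTop (𝓝 l)) :
    BddAbove (Set.range B) := by
  choose l hl using hd
  have hpos : 0 < (1 - γ) / 4 := by linarith
  obtain ⟨T, hT⟩ := eventually_atTop.1 (eventually_all.2 fun s =>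
    Metric.tendsto_nhds.1 (hl s) ((1 - γ) / 4 / 2) (half_pos hpos))
  refine ⟨B (T + 0) / (1 - 2 * ((1 - γ) / 4)), Set.forall_mem_range.2 fun t => ?_⟩
  refine (hf.monotone (Nat.le_add_left t T)).trans
    ((hf.shift T).le_div_of_norm_noise_le hpos.le (by linarith) (fun n s => ?_) t)
  rw [← Finset.sum_range_add_sub_sum_range (fun k => d k s), ← dist_eq_norm]
  exact ((dist_triangle_right _ _ (l s)).trans_lt
    (add_lt_add (hT (T + n) (Nat.le_add_right T n) s) (hT T le_rfl s))).le.trans_eq (add_halves _)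

theorem eventually_norm_le_mul_add [CompleteSpace E] (hf : IsNoisyContraction γ α f h d B)
    (hsum : ∀ s, Tendsto (fun n => ∑ t ∈ Finset.range n, α t s) atTop atTop)
    (hd : ∀ s, ∃ l, Tendsto (fun n => ∑ k ∈ Finset.range n, d k s) atTop (𝓝 l))
    (hB : BddAbove (Set.range B)) {D ε : ℝ} (hD : ∀ᶠ t in atTop, ‖f t‖ ≤ D) (hε : 0 < ε) :
    ∀ᶠ t in atTop, ‖f t‖ ≤ γ * D + ε := by
  have hD₀ : 0 ≤ D := hD.exists.elim fun t ht => (norm_nonneg _).trans ht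
  have hcoord : ∀ s, ∀ᶠ t in atTop, ‖f t s‖ ≤ γ * D + ε := fun s => by
    obtain ⟨W, hW⟩ : ∃ W, Tendsto (fun t => accumulatedNoise B d t s) atTop (𝓝 W) :=
      exists_tendsto_sum_range_smul hf.monotone hB (hd s).choose_spec
    have htail : ∀ᶠ t in atTop, ‖accumulatedNoise B d t s - W‖ < ε / 3 := by
      simpa only [dist_eq_norm] using Metric.tendsto_nhds.1 hW (ε / 3) (by positivity)
    have hcomp := eventually_norm_le_add_of_averaging (c := γ * D + ε / 3) (ε := ε / 3)
      (u := fun t => f t s - (accumulatedNoise B d t s - W))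
      (fun t => hf.stepSize_mem t s) (hsum s) (fun t => hf.sub_accumulatedNoise_succ W t s)
      (by
        filter_upwards [hD, htail] with t ht htail_t
        exact (norm_sub_le _ _).trans (add_le_add ((hf.target_le t s).trans
          (mul_le_mul_of_nonneg_left ht hf.nonneg)) htail_t.le)) (by positivity)
    filter_upwards [hcomp, htail] with t ht htail_t
    linarith [norm_le_norm_sub_add (f t s) (accumulatedNoise B d t s - W)]
  filter_upwards [eventually_all.2 hcoord] with t ht
  exact (pi_norm_le_iff_of_nonneg (add_nonneg (mul_nonneg hf.nonneg hD₀) hε.le)).2 ht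

theorem tendsto_zero [CompleteSpace E] (hf : IsNoisyContraction γ α f h d B) (hγ : γ < 1)
    (hsum : ∀ s, Tendsto (fun n => ∑ t ∈ Finset.range n, α t s) atTop atTop)
    (hd : ∀ s, ∃ l, Tendsto (fun n => ∑ k ∈ Finset.range n, d k s) atTop (𝓝 l)) :
    Tendsto f atTop (𝓝 0) := by
  have hB := hf.bddAbove_bound hγ hd
  obtain ⟨C, hC⟩ := hB
  exact tendsto_zero_of_eventually_norm_le_mul_add ⟨hf.nonneg, hγ⟩
    (.of_forall fun t => (hf.norm_le t).trans (hC ⟨t, rfl⟩))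
    fun D hD ε hε => hf.eventually_norm_le_mul_add hsum hd ⟨C, hC⟩ hD hε

end IsNoisyContraction

end NoisyContraction

section MartingaleTransform

variable {Ω : Type*} {m0 : MeasurableSpace Ω} {P : Measure Ω} {ℱ : Filtration ℕ m0}
  {k ξ : ℕ → Ω → ℝ} {C K N : ℝ}

/-- Martingale differences `ξ t` with common bound `C`; the index is the time of the conditioning,
so that `ξ t` is revealed at time `t + 1`. -/
structure IsBoundedMartingaleDifference (P : Measure Ω) (ℱ : Filtration ℕ m0) (C : ℝ)
    (ξ : ℕ → Ω → ℝ) : Prop where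
  measurable : ∀ t, Measurable[ℱ (t + 1)] (ξ t)
  ae_abs_le : ∀ t, ∀ᵐ ω ∂P, |ξ t ω| ≤ C
  condExp_eq_zero : ∀ t, P[ξ t | ℱ t] =ᵐ[P] 0

/-- The martingale transform `∑ t < n, k t * ξ t` of the increments `ξ` by the coefficients `k`. -/
def martingaleTransform (k ξ : ℕ → Ω → ℝ) (n : ℕ) (ω : Ω) : ℝ :=
  ∑ t ∈ Finset.range n, k t ω * ξ t ω

theorem martingaleTransform_succ (k ξ : ℕ → Ω → ℝ) (n : ℕ) (ω : Ω) :
    martingaleTransform k ξ (n + 1) ω = martingaleTransform k ξ n ω + k n ω * ξ n ω :=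
  Finset.sum_range_succ _ n

/-- The coefficients `k`, switched off as soon as their sum of squares exceeds `N`; used to localise
convergence results for martingale transforms. -/
noncomputable def truncatedCoefficient (N : ℝ) (k : ℕ → Ω → ℝ) (t : ℕ) : Ω → ℝ :=
  {ω | ∑ i ∈ Finset.range (t + 1), k i ω ^ 2 ≤ N}.indicator (k t)

theorem measurable_truncatedCoefficient (hk : ∀ t, Measurable[ℱ t] (k t)) (N : ℝ) (t : ℕ) :
    Measurable[ℱ t] (truncatedCoefficient N k t) := by
  have hsum : Measurable[ℱ t] fun ω => ∑ i ∈ Finset.range (t + 1), k i ω ^ 2 :=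
    Finset.measurable_fun_sum _ fun i hi =>
      ((hk i).mono (ℱ.mono (Finset.mem_range_succ_iff.1 hi)) le_rfl).pow_const 2
  exact (hk t).indicator (hsum measurableSet_Iic)

theorem sum_truncatedCoefficient_sq_le (hN : 0 ≤ N) (n : ℕ) (ω : Ω) :
    ∑ t ∈ Finset.range n, truncatedCoefficient N k t ω ^ 2 ≤ N := by
  induction n with
  | zero => simpa using hN
  | succ n ih =>
    by_cases h : ∑ i ∈ Finset.range (n + 1), k i ω ^ 2 ≤ N
    · refine (Finset.sum_le_sum fun t _ => ?_).trans h
      rw [truncatedCoefficient, Set.indicator_apply]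
      split_ifs
      · exact le_rfl
      · simpa using sq_nonneg (k t ω)
    · have hzero : truncatedCoefficient N k n ω = 0 :=
        Set.indicator_of_notMem (s := {ω | ∑ i ∈ Finset.range (n + 1), k i ω ^ 2 ≤ N}) h _
      rw [Finset.sum_range_succ, hzero]
      simpa using ih

theorem integrable_coefficient_sq [IsFiniteMeasure P] (hk : ∀ t, Measurable[ℱ t] (k t))
    (hk_abs : ∀ t ω, |k t ω| ≤ K) (t : ℕ) : Integrable (fun ω => k t ω ^ 2) P :=
  (MemLp.of_bound ((hk t).mono (ℱ.le t) le_rfl).aestronglyMeasurable K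
    (.of_forall (hk_abs t))).integrable_sq

namespace IsBoundedMartingaleDifference

theorem measurable_martingaleTransform (hξ : IsBoundedMartingaleDifference P ℱ C ξ)
    (hk : ∀ t, Measurable[ℱ t] (k t)) (n : ℕ) : Measurable[ℱ n] (martingaleTransform k ξ n) := by
  refine Finset.measurable_fun_sum _ fun t ht => ?_
  have htn : t + 1 ≤ n := Finset.mem_range.1 ht
  exact ((hk t).mono (ℱ.mono (t.le_succ.trans htn)) le_rfl).mul
    ((hξ.measurable t).mono (ℱ.mono htn) le_rfl)

theorem ae_abs_martingaleTransform_le (hξ : IsBoundedMartingaleDifference P ℱ C ξ)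
    (hk_abs : ∀ t ω, |k t ω| ≤ K) (n : ℕ) :
    ∀ᵐ ω ∂P, |martingaleTransform k ξ n ω| ≤ n * (K * C) := by
  filter_upwards [ae_all_iff.2 hξ.ae_abs_le] with ω hω
  calc |martingaleTransform k ξ n ω| ≤ ∑ t ∈ Finset.range n, |k t ω * ξ t ω| :=
        Finset.abs_sum_le_sum_abs _ _
    _ ≤ ∑ _t ∈ Finset.range n, K * C := Finset.sum_le_sum fun t _ => by
        rw [abs_mul]
        exact mul_le_mul (hk_abs t ω) (hω t) (abs_nonneg _) ((abs_nonneg _).trans (hk_abs t ω))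
    _ = n * (K * C) := by rw [Finset.sum_const, Finset.card_range, nsmul_eq_mul]

variable [IsFiniteMeasure P]

theorem integrable (hξ : IsBoundedMartingaleDifference P ℱ C ξ) (t : ℕ) : Integrable (ξ t) P :=
  .of_bound ((hξ.measurable t).mono (ℱ.le _) le_rfl).aestronglyMeasurable C (hξ.ae_abs_le t)

theorem integrable_mul (hξ : IsBoundedMartingaleDifference P ℱ C ξ) {t : ℕ} {g : Ω → ℝ}
    (hg : Measurable[ℱ t] g) (hgK : ∀ᵐ ω ∂P, |g ω| ≤ K) : Integrable (g * ξ t) P :=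
  (hξ.integrable t).bdd_mul (hg.mono (ℱ.le _) le_rfl).aestronglyMeasurable hgK

theorem condExp_mul_eq_zero (hξ : IsBoundedMartingaleDifference P ℱ C ξ) {t : ℕ} {g : Ω → ℝ}
    (hg : Measurable[ℱ t] g) (hgK : ∀ᵐ ω ∂P, |g ω| ≤ K) : P[g * ξ t | ℱ t] =ᵐ[P] 0 := by
  filter_upwards [condExp_stronglyMeasurable_mul_of_bound (ℱ.le t) hg.stronglyMeasurable
    (hξ.integrable t) K hgK, hξ.condExp_eq_zero t] with ω hmul hzero
  rw [hmul, Pi.mul_apply, hzero, Pi.zero_apply, mul_zero]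

theorem integral_mul_eq_zero (hξ : IsBoundedMartingaleDifference P ℱ C ξ) {t : ℕ} {g : Ω → ℝ}
    (hg : Measurable[ℱ t] g) (hgK : ∀ᵐ ω ∂P, |g ω| ≤ K) : ∫ ω, (g * ξ t) ω ∂P = 0 := by
  rw [← integral_condExp (ℱ.le t), integral_congr_ae (hξ.condExp_mul_eq_zero hg hgK)]
  exact integral_zero Ω ℝ

theorem integrable_martingaleTransform (hξ : IsBoundedMartingaleDifference P ℱ C ξ)
    (hk : ∀ t, Measurable[ℱ t] (k t)) (hk_abs : ∀ t ω, |k t ω| ≤ K) (n : ℕ) :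
    Integrable (martingaleTransform k ξ n) P :=
  .of_bound ((hξ.measurable_martingaleTransform hk n).mono (ℱ.le n) le_rfl).aestronglyMeasurable _
    (hξ.ae_abs_martingaleTransform_le hk_abs n)

theorem integrable_martingaleTransform_sq (hξ : IsBoundedMartingaleDifference P ℱ C ξ)
    (hk : ∀ t, Measurable[ℱ t] (k t)) (hk_abs : ∀ t ω, |k t ω| ≤ K) (n : ℕ) :
    Integrable (fun ω => martingaleTransform k ξ n ω ^ 2) P :=
  (MemLp.of_bound
    ((hξ.measurable_martingaleTransform hk n).mono (ℱ.le n) le_rfl).aestronglyMeasurable _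
    (hξ.ae_abs_martingaleTransform_le hk_abs n)).integrable_sq

theorem martingale_martingaleTransform (hξ : IsBoundedMartingaleDifference P ℱ C ξ)
    (hk : ∀ t, Measurable[ℱ t] (k t)) (hk_abs : ∀ t ω, |k t ω| ≤ K) :
    Martingale (martingaleTransform k ξ) ℱ P := by
  refine martingale_of_condExp_sub_eq_zero_nat
    (fun n => (hξ.measurable_martingaleTransform hk n).stronglyMeasurable)
    (hξ.integrable_martingaleTransform hk hk_abs) fun n => ?_
  have hincr : martingaleTransform k ξ (n + 1) - martingaleTransform k ξ n = k n * ξ n := by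
    ext ω
    rw [Pi.sub_apply, martingaleTransform_succ, add_sub_cancel_left, Pi.mul_apply]
  rw [hincr]
  exact hξ.condExp_mul_eq_zero (hk n) (.of_forall (hk_abs n))

theorem integral_martingaleTransform_sq_succ_le (hξ : IsBoundedMartingaleDifference P ℱ C ξ)
    (hk : ∀ t, Measurable[ℱ t] (k t)) (hk_abs : ∀ t ω, |k t ω| ≤ K) (n : ℕ) :
    ∫ ω, martingaleTransform k ξ (n + 1) ω ^ 2 ∂P
      ≤ ∫ ω, martingaleTransform k ξ n ω ^ 2 ∂P + C ^ 2 * ∫ ω, k n ω ^ 2 ∂P := by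
  set X := martingaleTransform k ξ with hX
  have hXk : Measurable[ℱ n] (X n * k n) := (hξ.measurable_martingaleTransform hk n).mul (hk n)
  have hXk_abs : ∀ᵐ ω ∂P, |(X n * k n) ω| ≤ n * (K * C) * K := by
    filter_upwards [hξ.ae_abs_martingaleTransform_le hk_abs n] with ω hω
    rw [Pi.mul_apply, abs_mul]
    exact mul_le_mul hω (hk_abs n ω) (abs_nonneg _) ((abs_nonneg _).trans hω)
  have hX_sq : ∀ n, Integrable (fun ω => X n ω ^ 2) P :=
    hξ.integrable_martingaleTransform_sq hk hk_abs
  have hcross := (hξ.integrable_mul hXk hXk_abs).const_mul 2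
  have hX_cross : Integrable (fun ω => X n ω ^ 2 + 2 * (X n * k n * ξ n) ω) P :=
    (hX_sq n).add hcross
  have hk_sq := (integrable_coefficient_sq (P := P) hk hk_abs n).const_mul (C ^ 2)
  have hpointwise : ∀ᵐ ω ∂P, X (n + 1) ω ^ 2
      ≤ X n ω ^ 2 + 2 * (X n * k n * ξ n) ω + C ^ 2 * k n ω ^ 2 := by
    filter_upwards [hξ.ae_abs_le n] with ω hω
    have hξ_sq : ξ n ω ^ 2 ≤ C ^ 2 := sq_le_sq' (abs_le.1 hω).1 (abs_le.1 hω).2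
    calc X (n + 1) ω ^ 2
        = X n ω ^ 2 + 2 * (X n * k n * ξ n) ω + ξ n ω ^ 2 * k n ω ^ 2 := by
          simp only [hX, martingaleTransform_succ, Pi.mul_apply]; ring
      _ ≤ _ := by gcongr
  calc ∫ ω, X (n + 1) ω ^ 2 ∂P
      ≤ ∫ ω, (X n ω ^ 2 + 2 * (X n * k n * ξ n) ω + C ^ 2 * k n ω ^ 2) ∂P :=
        integral_mono_ae (hX_sq (n + 1)) (hX_cross.add hk_sq) hpointwise
    _ = ∫ ω, X n ω ^ 2 ∂P + C ^ 2 * ∫ ω, k n ω ^ 2 ∂P := by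
        rw [integral_add hX_cross hk_sq, integral_add (hX_sq n) hcross,
          integral_const_mul, integral_const_mul, hξ.integral_mul_eq_zero hXk hXk_abs, mul_zero,
          add_zero]

theorem integral_martingaleTransform_sq_le (hξ : IsBoundedMartingaleDifference P ℱ C ξ)
    (hk : ∀ t, Measurable[ℱ t] (k t)) (hk_abs : ∀ t ω, |k t ω| ≤ K) (n : ℕ) :
    ∫ ω, martingaleTransform k ξ n ω ^ 2 ∂P
      ≤ C ^ 2 * ∫ ω, ∑ t ∈ Finset.range n, k t ω ^ 2 ∂P := by
  rw [integral_finsetSum _ fun t _ => integrable_coefficient_sq hk hk_abs t]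
  induction n with
  | zero => simp [martingaleTransform]
  | succ n ih =>
    rw [Finset.sum_range_succ, mul_add]
    exact (hξ.integral_martingaleTransform_sq_succ_le hk hk_abs n).trans (add_le_add_left ih _)

theorem ae_exists_tendsto_of_sum_sq_le (hξ : IsBoundedMartingaleDifference P ℱ C ξ)
    (hk : ∀ t, Measurable[ℱ t] (k t)) (hN : ∀ n ω, ∑ t ∈ Finset.range n, k t ω ^ 2 ≤ N) :
    ∀ᵐ ω ∂P, ∃ l, Tendsto (fun n => martingaleTransform k ξ n ω) atTop (𝓝 l) := by
  have hk_abs : ∀ t ω, |k t ω| ≤ √N := fun t ω =>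
    Real.abs_le_sqrt ((Finset.single_le_sum (f := fun t => k t ω ^ 2) (fun _ _ => sq_nonneg _)
      (Finset.self_mem_range_succ t)).trans (hN (t + 1) ω))
  have hk_sq : ∀ t, Integrable (fun ω => k t ω ^ 2) P := integrable_coefficient_sq hk hk_abs
  have hX := hξ.integrable_martingaleTransform hk hk_abs
  have hX_sq := hξ.integrable_martingaleTransform_sq hk hk_abs
  have hL1 : ∀ n, ∫ ω, ‖martingaleTransform k ξ n ω‖ ∂P
      ≤ ∫ _, (1 : ℝ) ∂P + C ^ 2 * ∫ _, N ∂P := fun n => by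
    calc ∫ ω, ‖martingaleTransform k ξ n ω‖ ∂P
        ≤ ∫ ω, (1 + martingaleTransform k ξ n ω ^ 2) ∂P := by
          refine integral_mono (hX n).norm ((integrable_const 1).add (hX_sq n)) fun ω => ?_
          change |martingaleTransform k ξ n ω| ≤ 1 + martingaleTransform k ξ n ω ^ 2
          rw [← sq_abs]
          nlinarith [sq_nonneg (|martingaleTransform k ξ n ω| - 1)]
      _ = ∫ _, (1 : ℝ) ∂P + ∫ ω, martingaleTransform k ξ n ω ^ 2 ∂P :=
          integral_add (integrable_const 1) (hX_sq n)
      _ ≤ ∫ _, (1 : ℝ) ∂P + C ^ 2 * ∫ _, N ∂P := by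
          refine add_le_add_right ((hξ.integral_martingaleTransform_sq_le hk hk_abs n).trans ?_) _
          exact mul_le_mul_of_nonneg_left (integral_mono (integrable_finsetSum _ fun t _ => hk_sq t)
            (integrable_const N) (hN n)) (sq_nonneg C)
  refine (hξ.martingale_martingaleTransform hk hk_abs).submartingale.exists_ae_tendsto_of_bdd
    (R := (∫ _, (1 : ℝ) ∂P + C ^ 2 * ∫ _, N ∂P).toNNReal) fun n => ?_
  rw [eLpNorm_one_eq_lintegral_enorm, ← ofReal_integral_norm_eq_lintegral_enorm (hX n)]
  exact ENNReal.ofReal_le_ofReal (hL1 n)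

theorem ae_exists_tendsto_of_summable_sq (hξ : IsBoundedMartingaleDifference P ℱ C ξ)
    (hk : ∀ t, Measurable[ℱ t] (k t)) (hk_sq : ∀ᵐ ω ∂P, Summable fun t => k t ω ^ 2) :
    ∀ᵐ ω ∂P, ∃ l, Tendsto (fun n => martingaleTransform k ξ n ω) atTop (𝓝 l) := by
  have hlocal : ∀ N : ℕ, ∀ᵐ ω ∂P, ∃ l,
      Tendsto (fun n => martingaleTransform (truncatedCoefficient N k) ξ n ω) atTop (𝓝 l) :=
    fun N => hξ.ae_exists_tendsto_of_sum_sq_le (measurable_truncatedCoefficient hk N)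
      (sum_truncatedCoefficient_sq_le N.cast_nonneg)
  filter_upwards [ae_all_iff.2 hlocal, hk_sq] with ω hω hsummable
  obtain ⟨N, hN⟩ := exists_nat_ge (∑' t, k t ω ^ 2)
  have heq : ∀ t, truncatedCoefficient N k t ω = k t ω := fun t =>
    Set.indicator_of_mem (s := {ω | ∑ i ∈ Finset.range (t + 1), k i ω ^ 2 ≤ N})
      ((hsummable.sum_le_tsum _ fun i _ => sq_nonneg _).trans hN) _
  simpa only [martingaleTransform, heq] using hω N

end IsBoundedMartingaleDifference

end MartingaleTransform

section StochasticApproximation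

variable {S Ω : Type*} [Fintype S] {m0 : MeasurableSpace Ω} {P : Measure Ω} {ℱ : Filtration ℕ m0}

/-- Adapted random step sizes that satisfy the Robbins–Monro conditions almost surely. -/
structure IsRobbinsMonro (P : Measure Ω) (ℱ : Filtration ℕ m0) (α : ℕ → Ω → ℝ) : Prop where
  measurable : ∀ t, Measurable[ℱ t] (α t)
  ae_mem_Icc : ∀ t, ∀ᵐ ω ∂P, α t ω ∈ Set.Icc (0 : ℝ) 1
  ae_tendsto_sum : ∀ᵐ ω ∂P, Tendsto (fun n => ∑ t ∈ Finset.range n, α t ω) atTop atTop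
  ae_summable_sq : ∀ᵐ ω ∂P, Summable fun t => α t ω ^ 2

/-- The running maximum of `max 1 ‖f i‖`, the bound of the iterates used to normalise the noise. It
is kept at least one so that it can be divided by. -/
noncomputable def runningBound (f : ℕ → S → ℝ) (t : ℕ) : ℝ :=
  partialSups (fun i => max 1 ‖f i‖) t

theorem max_one_norm_le_runningBound (f : ℕ → S → ℝ) (t : ℕ) : max 1 ‖f t‖ ≤ runningBound f t :=
  le_partialSups (fun i => max 1 ‖f i‖) t

theorem norm_le_runningBound (f : ℕ → S → ℝ) (t : ℕ) : ‖f t‖ ≤ runningBound f t :=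
  (le_max_right _ _).trans (max_one_norm_le_runningBound f t)

theorem runningBound_pos (f : ℕ → S → ℝ) (t : ℕ) : 0 < runningBound f t :=
  zero_lt_one.trans_le ((le_max_left _ _).trans (max_one_norm_le_runningBound f t))

theorem runningBound_succ_le (f : ℕ → S → ℝ) (t : ℕ) :
    runningBound f (t + 1) ≤ max (runningBound f t) ‖f (t + 1)‖ := by
  have hone : 1 ≤ runningBound f t :=
    (le_max_left _ _).trans (max_one_norm_le_runningBound f t)
  rw [runningBound, partialSups_add_one, ← runningBound]
  exact sup_le (le_max_left _ _) (max_le (le_max_of_le_left hone) (le_max_right _ _))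

theorem measurable_runningBound {f : ℕ → Ω → S → ℝ} (hf : ∀ t, Measurable[ℱ t] (f t)) (t : ℕ) :
    Measurable[ℱ t] fun ω => runningBound (fun i => f i ω) t := by
  induction t with
  | zero =>
    simp only [runningBound, partialSups_zero]
    exact measurable_const.max (measurable_norm.comp (hf 0))
  | succ t ih =>
    simp only [runningBound, partialSups_add_one]
    exact (ih.mono (ℱ.mono t.le_succ) le_rfl).max
      (measurable_const.max (measurable_norm.comp (hf (t + 1))))

/-- The coefficient of the noise when the iterates are normalised by their running bound. -/
noncomputable def noiseCoefficient (α : ℕ → Ω → ℝ) (f : ℕ → Ω → S → ℝ) (t : ℕ) (ω : Ω) : ℝ :=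
  α t ω * (max 1 ‖f t ω‖ / runningBound (fun i => f i ω) t)

theorem measurable_noiseCoefficient {α : ℕ → Ω → ℝ} {f : ℕ → Ω → S → ℝ}
    (hα : ∀ t, Measurable[ℱ t] (α t)) (hf : ∀ t, Measurable[ℱ t] (f t)) (t : ℕ) :
    Measurable[ℱ t] (noiseCoefficient α f t) :=
  (hα t).mul
    ((measurable_const.max (measurable_norm.comp (hf t))).div (measurable_runningBound hf t))

theorem noiseCoefficient_sq_le (α : ℕ → Ω → ℝ) (f : ℕ → Ω → S → ℝ) (t : ℕ) (ω : Ω) :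
    noiseCoefficient α f t ω ^ 2 ≤ α t ω ^ 2 := by
  have hpos := runningBound_pos (fun i => f i ω) t
  rw [noiseCoefficient, mul_pow]
  refine mul_le_of_le_one_right (sq_nonneg _) (pow_le_one₀ ?_ ?_)
  · exact div_nonneg (zero_le_one.trans (le_max_left _ _)) hpos.le
  · exact div_le_one_of_le₀ (max_one_norm_le_runningBound (fun i => f i ω) t) hpos.le

theorem runningBound_mul_noiseCoefficient (α : ℕ → Ω → ℝ) (f : ℕ → Ω → S → ℝ) (t : ℕ) (ω : Ω) :
    runningBound (fun i => f i ω) t * noiseCoefficient α f t ω = α t ω * max 1 ‖f t ω‖ := by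
  rw [noiseCoefficient, mul_left_comm, mul_div_cancel₀ _ (runningBound_pos _ t).ne']

theorem ae_tendsto_zero_of_contracting_targets [IsFiniteMeasure P] {f h : ℕ → Ω → S → ℝ}
    {α ξ : S → ℕ → Ω → ℝ} {C : S → ℝ} {γ : ℝ} (hγ : γ ∈ Set.Ico (0 : ℝ) 1)
    (hf : ∀ t, Measurable[ℱ t] (f t)) (hα : ∀ s, IsRobbinsMonro P ℱ (α s))
    (hξ : ∀ s, IsBoundedMartingaleDifference P ℱ (C s) (ξ s))
    (htarget : ∀ᵐ ω ∂P, ∀ t s, |h t ω s| ≤ γ * ‖f t ω‖)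
    (hstep : ∀ᵐ ω ∂P, ∀ t s, f (t + 1) ω s
      = f t ω s + α s t ω * (h t ω s - f t ω s + max 1 ‖f t ω‖ * ξ s t ω)) :
    ∀ᵐ ω ∂P, Tendsto (fun t => f t ω) atTop (𝓝 0) := by
  have hnoise : ∀ᵐ ω ∂P, ∀ s, ∃ l, Tendsto
      (fun n => martingaleTransform (noiseCoefficient (α s) f) (ξ s) n ω) atTop (𝓝 l) := by
    refine ae_all_iff.2 fun s => (hξ s).ae_exists_tendsto_of_summable_sq
      (measurable_noiseCoefficient (hα s).measurable hf) ?_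
    filter_upwards [(hα s).ae_summable_sq] with ω hω
    exact hω.of_nonneg_of_le (fun t => sq_nonneg _) fun t => noiseCoefficient_sq_le (α s) f t ω
  filter_upwards [hnoise, htarget, hstep, ae_all_iff.2 fun s => (hα s).ae_tendsto_sum,
    ae_all_iff.2 fun s => ae_all_iff.2 (hα s).ae_mem_Icc] with ω hnoise htarget hstep hsum hmem
  have hcontraction : IsNoisyContraction γ (fun t s => α s t ω) (fun t => f t ω) (fun t => h t ω)
      (fun t s => noiseCoefficient (α s) f t ω * ξ s t ω) (runningBound fun t => f t ω) :=
    { nonneg := hγ.1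
      stepSize_mem := fun t s => hmem s t
      step := fun t s => by
        simp only [smul_eq_mul]
        rw [← mul_assoc, runningBound_mul_noiseCoefficient, hstep]
        ring
      target_le := htarget
      monotone := (partialSups _).monotone
      norm_le := norm_le_runningBound _
      succ_le := runningBound_succ_le _ }
  exact hcontraction.tendsto_zero hγ.2 hsum hnoise

end StochasticApproximation

section StepExpectation

variable {S A : Type*} [Fintype S] [Fintype A]

/-- The expectation of `F a s' r` over the action `a`, the next state `s'` and the reward `r` when
the option `o` is followed for one step from `s`. -/
noncomputable def stepExpectation (M : FiniteMDP S A) (o : MDPOption S A) (s : S)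
    (F : A → S → ℝ → ℝ) : ℝ :=
  ∑ a, ∑ s', ∑ r : M.rewards, o.policy a s * M.p s' r s a * F a s' r

variable (M : FiniteMDP S A) (o : MDPOption S A) (s : S)

theorem stepExpectation_const (c : ℝ) : stepExpectation M o s (fun _ _ _ => c) = c := by
  simp only [stepExpectation, ← Finset.sum_mul, ← Finset.mul_sum, M.p_sum, mul_one, o.policy_sum,
    one_mul]

theorem stepExpectation_add (F G : A → S → ℝ → ℝ) :
    stepExpectation M o s (fun a s' r => F a s' r + G a s' r)
      = stepExpectation M o s F + stepExpectation M o s G := by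
  simp only [stepExpectation, mul_add, Finset.sum_add_distrib]

theorem stepExpectation_const_mul (c : ℝ) (F : A → S → ℝ → ℝ) :
    stepExpectation M o s (fun a s' r => c * F a s' r) = c * stepExpectation M o s F := by
  simp only [stepExpectation, mul_left_comm _ c, ← Finset.mul_sum]

theorem abs_stepExpectation_le {F G : A → S → ℝ → ℝ}
    (h : ∀ a s', ∀ r ∈ M.rewards, |F a s' r| ≤ G a s' r) :
    |stepExpectation M o s F| ≤ stepExpectation M o s G := by
  have hprob : ∀ a s' r, 0 ≤ o.policy a s * M.p s' r s a := fun a s' r =>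
    mul_nonneg (o.policy_nonneg a s) (M.p_nonneg s' r s a)
  refine (Finset.abs_sum_le_sum_abs _ _).trans (Finset.sum_le_sum fun a _ => ?_)
  refine (Finset.abs_sum_le_sum_abs _ _).trans (Finset.sum_le_sum fun s' _ => ?_)
  refine (Finset.abs_sum_le_sum_abs _ _).trans (Finset.sum_le_sum fun r _ => ?_)
  rw [abs_mul, abs_of_nonneg (hprob a s' r)]
  exact mul_le_mul_of_nonneg_left (h a s' r r.2) (hprob a s' r)

theorem stepExpectation_importanceRatio_mul {O : Type*} (opts : O → MDPOption S A) (o o' : O)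
    (hcover : ∀ a, (opts o').policy a s = 0 → (opts o).policy a s = 0) (F : A → S → ℝ → ℝ) :
    stepExpectation M (opts o') s (fun a s' r => importanceRatio opts a s o o' * F a s' r)
      = stepExpectation M (opts o) s F := by
  refine Finset.sum_congr rfl fun a _ => Finset.sum_congr rfl fun s' _ =>
    Finset.sum_congr rfl fun r _ => ?_
  have hratio : importanceRatio opts a s o o' * (opts o').policy a s = (opts o).policy a s :=
    div_mul_cancel_of_imp (hcover a)
  rw [← hratio]
  ring

end StepExpectation

section ExecutionPaths

open Matrix (vecCons)

variable {S A : Type*} [Fintype S] [Fintype A]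

theorem sum_pi_fin_succ {T R : Type*} [Fintype T] [AddCommMonoid R] {n : ℕ}
    (f : (Fin (n + 1) → T) → R) : ∑ x, f x = ∑ t, ∑ x : Fin n → T, f (vecCons t x) := by
  rw [← Fintype.sum_prod_type' fun t (x : Fin n → T) => f (vecCons t x)]
  exact (Fintype.sum_equiv (Fin.consEquiv fun _ => T) _ _ fun _ => rfl).symm

variable (M : FiniteMDP S A) (o : MDPOption S A)

theorem executionProb_vecCons (n : ℕ) (s : S) (x : Fin (n + 2) → S) (b : A) (a : Fin (n + 1) → A)
    (v : M.rewards) (u : Fin (n + 1) → M.rewards) :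
    executionProb M o (n + 1) (vecCons s x) (vecCons b a) (vecCons v u)
      = o.policy b s * M.p (x 0) v s b * (1 - o.termination (x 0)) * executionProb M o n x a u := by
  rw [executionProb, executionProb, Fin.prod_univ_succ,
    Fin.prod_univ_succ fun i : Fin (n + 1) =>
      1 - o.termination ((vecCons s x : Fin (n + 3) → S) i.succ.castSucc)]
  simp only [← Fin.succ_last, ← Fin.succ_castSucc, Matrix.cons_val_succ, Matrix.cons_val_zero,
    Fin.castSucc_zero]
  ring

open Classical in
theorem optionTransitionProb_one (s x : S) (r : ℝ) :
    optionTransitionProb M o s x r 1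
      = stepExpectation M o s fun _ s' v => if s' = x ∧ v = r then o.termination s' else 0 := by
  rw [optionTransitionProb, sum_pi_fin_succ,
    Finset.sum_eq_single s (fun s' _ hs' => by simp [hs']) (by simp)]
  simp only [sum_pi_fin_succ, Fintype.sum_unique]
  rw [stepExpectation, Finset.sum_comm]
  simp [executionProb]

theorem optionTransitionProb_add_two (s x : S) (r : ℝ) (n : ℕ) :
    optionTransitionProb M o s x r (n + 2) = stepExpectation M o s fun _ s' v =>
      (1 - o.termination s') * optionTransitionProb M o s' x (r - v) (n + 1) := by
  classical
  have hswap : ∀ F : (Fin (n + 2) → S) → A → (Fin (n + 1) → A) → M.rewards →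
      (Fin (n + 1) → M.rewards) → ℝ, ∑ y, ∑ b, ∑ a, ∑ v, ∑ u, F y b a v u
        = ∑ b, ∑ v, ∑ y, ∑ a, ∑ u, F y b a v u := fun F => by
    rw [Finset.sum_comm]
    exact Finset.sum_congr rfl fun b _ =>
      (Finset.sum_congr rfl fun y _ => Finset.sum_comm).trans Finset.sum_comm
  rw [optionTransitionProb, sum_pi_fin_succ,
    Finset.sum_eq_single s (fun s' _ hs' => by simp [hs']) (by simp)]
  simp only [sum_pi_fin_succ (T := A) (n := n + 1), sum_pi_fin_succ (T := M.rewards) (n := n + 1)]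
  rw [hswap, stepExpectation]
  refine Finset.sum_congr rfl fun b _ => ?_
  rw [Finset.sum_comm (s := (Finset.univ : Finset S))]
  refine Finset.sum_congr rfl fun v _ => ?_
  simp only [optionTransitionProb, Finset.mul_sum]
  rw [Finset.sum_comm (s := (Finset.univ : Finset S))]
  refine Finset.sum_congr rfl fun y _ => ?_
  rw [Finset.sum_eq_single (y 0) (fun s' _ hs' => by simp [hs'.symm]) (by simp)]
  refine Finset.sum_congr rfl fun a _ => Finset.sum_congr rfl fun u _ => ?_
  rw [executionProb_vecCons, ← Fin.succ_last, Matrix.cons_val_succ, Fin.sum_univ_succ]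
  simp only [Matrix.cons_val_zero, Matrix.cons_val_succ, true_and, ← eq_sub_iff_add_eq']
  split_ifs
  · ring
  · simp

open Classical in
/-- The probability that, after the option `o` has arrived in the state `s'` with the reward `v`,
its execution terminates in `z.1` after `z.2.2` further steps with cumulative reward `z.2.1`, where
`v` is included. -/
noncomputable def arrivalTransitionProb (s' : S) (v : ℝ) (z : S × ℝ × ℕ) : ℝ :=
  (if z = (s', v, 0) then o.termination s' else 0) +
    (1 - o.termination s') * optionTransitionProb M o s' z.1 (z.2.1 - v) z.2.2

theorem optionTransitionProb_succ (s x : S) (r : ℝ) (l : ℕ) :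
    optionTransitionProb M o s x r (l + 1)
      = stepExpectation M o s fun _ s' v => arrivalTransitionProb M o s' v (x, r, l) := by
  classical
  cases l with
  | zero =>
    have hzero : ∀ s' r', optionTransitionProb M o s' x r' 0 = 0 := fun _ _ => rfl
    simp [optionTransitionProb_one, arrivalTransitionProb, hzero, eq_comm]
  | succ n => simp [optionTransitionProb_add_two, arrivalTransitionProb]

theorem hasSum_arrivalTransitionProb_mul {s' : S} {v e : ℝ} {g : S × ℝ × ℕ → ℝ}
    (he : HasSum (fun z : S × ℝ × ℕ => optionTransitionProb M o s' z.1 z.2.1 z.2.2 *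
      g (z.1, z.2.1 + v, z.2.2)) e) :
    HasSum (fun z => arrivalTransitionProb M o s' v z * g z)
      (o.termination s' * g (s', v, 0) + (1 - o.termination s') * e) := by
  classical
  simp only [arrivalTransitionProb, add_mul]
  refine HasSum.add ?_ ?_
  · have hsingle := hasSum_single (f := fun z : S × ℝ × ℕ =>
      (if z = (s', v, 0) then o.termination s' else 0) * g z) (s', v, 0)
      (fun z hz => by simp [hz])
    simpa only [if_true] using hsingle
  · let shift : S × ℝ × ℕ ≃ S × ℝ × ℕ :=
      (Equiv.refl S).prodCongr ((Equiv.addRight v).prodCongr (Equiv.refl ℕ))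
    rw [← shift.hasSum_iff]
    refine (he.mul_left (1 - o.termination s')).congr_fun fun z => ?_
    simp [shift, Prod.map, mul_assoc]

theorem hasSum_optionTransitionProb_mul (s : S) (g : S × ℝ × ℕ → ℝ) (e : S → ℝ → ℝ)
    (he : ∀ s' v, HasSum (fun z : S × ℝ × ℕ => optionTransitionProb M o s' z.1 z.2.1 z.2.2 *
      g (z.1, z.2.1 + v, z.2.2 + 1)) (e s' v)) :
    HasSum (fun z : S × ℝ × ℕ => optionTransitionProb M o s z.1 z.2.1 z.2.2 * g z)
      (stepExpectation M o s fun _ s' v =>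
        o.termination s' * g (s', v, 1) + (1 - o.termination s') * e s' v) := by
  have hinj : Function.Injective fun z : S × ℝ × ℕ => (z.1, z.2.1, z.2.2 + 1) := by
    rintro ⟨x, r, l⟩ ⟨x', r', l'⟩ h
    simpa using h
  rw [← hinj.hasSum_iff]
  · have harrival := fun s' v => hasSum_arrivalTransitionProb_mul M o
      (g := fun z => g (z.1, z.2.1, z.2.2 + 1)) (he s' v)
    have hsum := hasSum_sum (s := Finset.univ) fun (b : A) _ => hasSum_sum (s := Finset.univ)
      fun (s' : S) _ => hasSum_sum (s := Finset.univ) fun (v : M.rewards) _ =>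
        (harrival s' v).mul_left (o.policy b s * M.p s' v s b)
    refine hsum.congr_fun fun z => ?_
    simp only [Function.comp, optionTransitionProb_succ, stepExpectation, Finset.sum_mul, mul_assoc]
  · rintro ⟨x, r, l⟩ h
    cases l with
    | zero => simp [optionTransitionProb]
    | succ l => exact absurd ⟨(x, r, l), rfl⟩ h

end ExecutionPaths

section BellmanEquations

variable {S A : Type*} [Fintype S] [Fintype A] (M : FiniteMDP S A) (o : MDPOption S A)

open Classical in
theorem dynamicsModel_eq_tsum (x s : S) :
    dynamicsModel M o x s = ∑' z : S × ℝ × ℕ,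
      optionTransitionProb M o s z.1 z.2.1 z.2.2 * (if z.1 = x then 1 else 0) := by
  have hinj : Function.Injective fun y : ℝ × ℕ => (x, y) := fun y y' h => by simpa using h
  rw [dynamicsModel, ← hinj.tsum_eq]
  · simp
  · rintro ⟨x', y⟩ h
    by_cases hx : x' = x
    · exact ⟨y, by rw [hx]⟩
    · simp [hx] at h

theorem exists_durationModel_sub_one_le :
    ∃ γ ∈ Set.Ico (0 : ℝ) 1, ∀ s, durationModel M o s - 1 ≤ γ * durationModel M o s := by
  obtain ⟨B, hB⟩ := Finite.exists_le (durationModel M o)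
  have hpos : 0 < max 1 B := one_pos.trans_le (le_max_left 1 B)
  refine ⟨1 - (max 1 B)⁻¹,
    ⟨sub_nonneg.2 (inv_le_one_of_one_le₀ (le_max_left 1 B)), sub_lt_self 1 (inv_pos.2 hpos)⟩,
    fun s => ?_⟩
  have hle : (max 1 B)⁻¹ * durationModel M o s ≤ 1 := by
    rw [inv_mul_le_iff₀ hpos, mul_one]
    exact (hB s).trans (le_max_right 1 B)
  linarith

variable {M o} (hfinite : ∀ s, FiniteExpectedDuration M o s)

include hfinite

open Classical in
theorem dynamicsModel_eq_stepExpectation (x s : S) :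
    dynamicsModel M o x s = stepExpectation M o s fun _ s' _ =>
      o.termination s' * (if s' = x then 1 else 0) +
        (1 - o.termination s') * dynamicsModel M o x s' := by
  rw [dynamicsModel_eq_tsum]
  refine (hasSum_optionTransitionProb_mul M o s (fun z => if z.1 = x then 1 else 0)
    (fun s' _ => dynamicsModel M o x s') fun s' v => ?_).tsum_eq
  rw [dynamicsModel_eq_tsum]
  have hprob := fun z : S × ℝ × ℕ => optionTransitionProb_nonneg M o s' z.1 z.2.1 z.2.2
  refine (Summable.of_nonneg_of_le (fun z => ?_) (fun z => ?_) (hfinite s').1.summable).hasSum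
  · exact mul_nonneg (hprob z) (by split_ifs <;> norm_num)
  · exact mul_le_of_le_one_right (hprob z) (by split_ifs <;> norm_num)

theorem rewardModel_eq_stepExpectation (s : S) :
    rewardModel M o s = stepExpectation M o s fun _ s' r =>
      r + (1 - o.termination s') * rewardModel M o s' := by
  refine (hasSum_optionTransitionProb_mul M o s (fun z => z.2.1)
    (fun s' v => rewardModel M o s' + 1 * v) fun s' v => ?_).tsum_eq.trans ?_
  · simp only [mul_add]
    exact (summable_rewardModel M o s' (hfinite s')).hasSum.add ((hfinite s').1.mul_right v)
  · congr 1
    ext _ s' r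
    ring

theorem durationModel_eq_stepExpectation (s : S) :
    durationModel M o s = stepExpectation M o s fun _ s' _ =>
      1 + (1 - o.termination s') * durationModel M o s' := by
  refine (hasSum_optionTransitionProb_mul M o s (fun z => (z.2.2 : ℝ))
    (fun s' _ => durationModel M o s' + 1 * 1) fun s' v => ?_).tsum_eq.trans ?_
  · simp only [Nat.cast_add, Nat.cast_one, mul_add]
    exact (hfinite s').2.hasSum.add ((hfinite s').1.mul_right 1)
  · congr 1
    ext _ s' r
    push_cast
    ring

theorem one_le_durationModel (s : S) : 1 ≤ durationModel M o s := by
  have hle : ∀ z : S × ℝ × ℕ, optionTransitionProb M o s z.1 z.2.1 z.2.2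
      ≤ optionTransitionProb M o s z.1 z.2.1 z.2.2 * (z.2.2 : ℝ)
    | (x, r, 0) => by simp [optionTransitionProb]
    | (x, r, l + 1) => le_mul_of_one_le_right (optionTransitionProb_nonneg M o s x r (l + 1))
        (by exact_mod_cast l.succ_pos)
  exact hasSum_le hle (hfinite s).1 (hfinite s).2.hasSum

theorem durationModel_pos (s : S) : 0 < durationModel M o s :=
  one_pos.trans_le (one_le_durationModel hfinite s)

theorem stepExpectation_continuation_durationModel (s : S) :
    stepExpectation M o s (fun _ s' _ => (1 - o.termination s') * durationModel M o s')
      = durationModel M o s - 1 := by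
  have hbellman := durationModel_eq_stepExpectation hfinite s
  rw [stepExpectation_add M o s fun _ _ _ => 1, stepExpectation_const] at hbellman
  linarith

end BellmanEquations

section WeightedContinuation

variable {S A : Type*} [Fintype S] [Fintype A] {M : FiniteMDP S A} {o : MDPOption S A}

/-- The expected value of `f` at the next state if the option `o` continues there, in the
coordinates in which values are divided by expected durations. -/
noncomputable def weightedContinuation (M : FiniteMDP S A) (o : MDPOption S A) (f : S → ℝ)
    (s : S) : ℝ :=
  (stepExpectation M o s fun _ s' _ => (1 - o.termination s') * (durationModel M o s' * f s')) /
    durationModel M o s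

-- The expected duration drops by one in each step, so it is a strict Lyapunov function.
theorem abs_weightedContinuation_le (hfinite : ∀ s, FiniteExpectedDuration M o s) {γ : ℝ}
    (hγ : ∀ s, durationModel M o s - 1 ≤ γ * durationModel M o s) (f : S → ℝ) (s : S) :
    |weightedContinuation M o f s| ≤ γ * ‖f‖ := by
  have hpos := durationModel_pos hfinite
  rw [weightedContinuation, abs_div, abs_of_pos (hpos s), div_le_iff₀ (hpos s)]
  calc
    _ ≤ stepExpectation M o s fun _ s' _ =>
        ‖f‖ * ((1 - o.termination s') * durationModel M o s') := by
      refine abs_stepExpectation_le M o s fun _ s' _ _ => ?_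
      have hweight : 0 ≤ (1 - o.termination s') * durationModel M o s' :=
        mul_nonneg (sub_nonneg.2 (o.termination_le_one s')) (hpos s').le
      rw [← mul_assoc, abs_mul, abs_of_nonneg hweight, mul_comm]
      exact mul_le_mul_of_nonneg_right (norm_le_pi_norm f s') hweight
    _ = ‖f‖ * (durationModel M o s - 1) := by
      rw [stepExpectation_const_mul, stepExpectation_continuation_durationModel hfinite]
    _ ≤ ‖f‖ * (γ * durationModel M o s) := mul_le_mul_of_nonneg_left (hγ s) (norm_nonneg f)
    _ = γ * ‖f‖ * durationModel M o s := by ring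

end WeightedContinuation

section TransitionNoise

variable {S A O Ω : Type*} [Fintype S] [Fintype A] {M : FiniteMDP S A} {opts : O → MDPOption S A}
  {St : ℕ → Ω → S} {Ot : ℕ → Ω → O} {At : ℕ → Ω → A} {Rt : ℕ → Ω → ℝ}

/-- The indicator of the event that the action `a` is taken at time `t` and leads to the next state
`s'` and the reward `r`. -/
noncomputable def transitionIndicator (St : ℕ → Ω → S) (At : ℕ → Ω → A) (Rt : ℕ → Ω → ℝ) (t : ℕ)
    (a : A) (s' : S) (r : ℝ) : Ω → ℝ :=
  {ω | At t ω = a ∧ St (t + 1) ω = s' ∧ Rt (t + 1) ω = r}.indicator fun _ => 1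

/-- The conditional probability of the transition `(a, s', r)` at time `t`, given the past. -/
def transitionProb (M : FiniteMDP S A) (opts : O → MDPOption S A) (St : ℕ → Ω → S)
    (Ot : ℕ → Ω → O) (t : ℕ) (a : A) (s' : S) (r : M.rewards) (ω : Ω) : ℝ :=
  (opts (Ot t ω)).policy a (St t ω) * M.p s' r (St t ω) a

/-- The value of `g t` at the observed transition minus its conditional expectation given the past.
Observed values enter through indicators, so that `g t` need not be measurable in the reward. -/
noncomputable def transitionNoise (M : FiniteMDP S A) (opts : O → MDPOption S A) (St : ℕ → Ω → S)
    (Ot : ℕ → Ω → O) (At : ℕ → Ω → A) (Rt : ℕ → Ω → ℝ) (g : ℕ → Ω → A → S → ℝ → ℝ)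
    (t : ℕ) (ω : Ω) : ℝ :=
  ∑ a, ∑ s', ∑ r : M.rewards, g t ω a s' r *
    (transitionIndicator St At Rt t a s' r ω - transitionProb M opts St Ot t a s' r ω)

theorem transitionNoise_eq_sub_stepExpectation (g : ℕ → Ω → A → S → ℝ → ℝ) (t : ℕ) (ω : Ω) :
    transitionNoise M opts St Ot At Rt g t ω
      = (∑ a, ∑ s', ∑ r : M.rewards, g t ω a s' r * transitionIndicator St At Rt t a s' r ω)
        - stepExpectation M (opts (Ot t ω)) (St t ω) (g t ω) := by
  simp only [transitionNoise, mul_sub, Finset.sum_sub_distrib, stepExpectation, transitionProb,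
    mul_comm (g t ω _ _ _) (MDPOption.policy _ _ _ * _)]

theorem transitionNoise_of_reward_mem {t : ℕ} {ω : Ω} (hR : Rt (t + 1) ω ∈ M.rewards)
    (g : ℕ → Ω → A → S → ℝ → ℝ) :
    transitionNoise M opts St Ot At Rt g t ω = g t ω (At t ω) (St (t + 1) ω) (Rt (t + 1) ω)
      - stepExpectation M (opts (Ot t ω)) (St t ω) (g t ω) := by
  rw [transitionNoise_eq_sub_stepExpectation]
  simp only [transitionIndicator]
  rw [Finset.sum_eq_single (At t ω) (fun a _ ha => by simp [ha.symm]) (by simp),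
    Finset.sum_eq_single (St (t + 1) ω) (fun s _ hs => by simp [hs.symm]) (by simp),
    Finset.sum_eq_single ⟨Rt (t + 1) ω, hR⟩
      (fun r _ hr => by
        have hne : Rt (t + 1) ω ≠ r := fun h => hr (Subtype.ext h.symm)
        simp [hne]) (by simp)]
  simp

theorem transitionNoise_of_reward_notMem {t : ℕ} {ω : Ω} (hR : Rt (t + 1) ω ∉ M.rewards)
    (g : ℕ → Ω → A → S → ℝ → ℝ) :
    transitionNoise M opts St Ot At Rt g t ω
      = -stepExpectation M (opts (Ot t ω)) (St t ω) (g t ω) := by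
  rw [transitionNoise_eq_sub_stepExpectation, sub_eq_neg_self]
  refine Finset.sum_eq_zero fun a _ => Finset.sum_eq_zero fun s' _ =>
    Finset.sum_eq_zero fun r _ => mul_eq_zero_of_right _ ?_
  exact Set.indicator_of_notMem
    (s := {ω | At t ω = a ∧ St (t + 1) ω = s' ∧ Rt (t + 1) ω = (r : ℝ)})
    (fun h => hR (h.2.2.symm ▸ r.2)) _

theorem measurable_comp_of_countable {T E : Type*} [Countable T] [MeasurableSpace E]
    {m : MeasurableSpace Ω} {X : Ω → T} (hX : Measurable[m, ⊤] X) {F : T → Ω → E}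
    (hF : ∀ x, Measurable[m] (F x)) : Measurable[m] fun ω => F (X ω) ω := by
  intro U hU
  have hpreimage : (fun ω => F (X ω) ω) ⁻¹' U = ⋃ x, X ⁻¹' {x} ∩ F x ⁻¹' U := by
    ext ω; simp
  rw [hpreimage]
  exact MeasurableSet.iUnion fun x => (hX trivial).inter (hF x hU)

namespace IsExperience

variable [MeasurableSpace Ω] {P : Measure Ω}
  {ℱ : Filtration ℕ (inferInstance : MeasurableSpace Ω)}

theorem measurable_transitionIndicator (hexp : IsExperience P ℱ M opts St Ot At Rt)
    (t : ℕ) (a : A) (s' : S) (r : ℝ) :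
    Measurable[ℱ (t + 1)] (transitionIndicator St At Rt t a s' r) := by
  refine measurable_const.indicator (MeasurableSet.inter ?_ (MeasurableSet.inter ?_ ?_))
  · exact hexp.measurable_action t (show MeasurableSet[⊤] {a} from trivial)
  · exact hexp.measurable_state (t + 1) (show MeasurableSet[⊤] {s'} from trivial)
  · exact hexp.measurable_reward t (measurableSet_singleton r)

theorem measurable_transitionProb [Countable O] (hexp : IsExperience P ℱ M opts St Ot At Rt)
    (t : ℕ) (a : A) (s' : S) (r : M.rewards) :
    Measurable[ℱ t] (transitionProb M opts St Ot t a s' r) :=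
  measurable_comp_of_countable (hexp.measurable_state t)
    (F := fun s ω => (opts (Ot t ω)).policy a s * M.p s' r s a) fun s =>
      measurable_comp_of_countable (hexp.measurable_option t)
        (F := fun o _ => (opts o).policy a s * M.p s' r s a) fun _ => measurable_const

theorem integrable_transitionIndicator [IsFiniteMeasure P]
    (hexp : IsExperience P ℱ M opts St Ot At Rt) (t : ℕ) (a : A) (s' : S) (r : ℝ) :
    Integrable (transitionIndicator St At Rt t a s' r) P := by
  refine .of_bound ((hexp.measurable_transitionIndicator t a s' r).mono
    (ℱ.le _) le_rfl).aestronglyMeasurable 1 (.of_forall fun ω => ?_)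
  exact (norm_indicator_le_norm_self _ ω).trans norm_one.le

theorem integrable_transitionProb (hexp : IsExperience P ℱ M opts St Ot At Rt) (t : ℕ) (a : A)
    (s' : S) (r : M.rewards) : Integrable (transitionProb M opts St Ot t a s' r) P :=
  integrable_condExp.congr (hexp.transition t a s' r)

variable [IsFiniteMeasure P] [Countable O] {g : ℕ → Ω → A → S → ℝ → ℝ} {C : ℝ}

theorem condExp_indicator_sub_transitionProb (hexp : IsExperience P ℱ M opts St Ot At Rt)
    (t : ℕ) (a : A) (s' : S) (r : M.rewards) :
    P[transitionIndicator St At Rt t a s' r - transitionProb M opts St Ot t a s' r | ℱ t]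
      =ᵐ[P] 0 := by
  have hprob := condExp_of_stronglyMeasurable (ℱ.le t)
    (hexp.measurable_transitionProb t a s' r).stronglyMeasurable
    (hexp.integrable_transitionProb t a s' r)
  filter_upwards [condExp_sub (hexp.integrable_transitionIndicator t a s' r)
    (hexp.integrable_transitionProb t a s' r) (ℱ t), hexp.transition t a s' r] with ω hsub hind
  rw [hsub, Pi.sub_apply, hprob]
  exact sub_eq_zero.2 hind

theorem condExp_transitionNoise (hexp : IsExperience P ℱ M opts St Ot At Rt) {t : ℕ}
    (hg : ∀ a s', ∀ r ∈ M.rewards, Measurable[ℱ t] fun ω => g t ω a s' r)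
    (hgC : ∀ ω a s', ∀ r ∈ M.rewards, |g t ω a s' r| ≤ C) :
    P[transitionNoise M opts St Ot At Rt g t | ℱ t] =ᵐ[P] 0 := by
  set Z : A → S → M.rewards → Ω → ℝ := fun a s' r =>
    transitionIndicator St At Rt t a s' r - transitionProb M opts St Ot t a s' r with hZ
  have hZ_int : ∀ a s' r, Integrable (Z a s' r) P := fun a s' r =>
    (hexp.integrable_transitionIndicator t a s' r).sub (hexp.integrable_transitionProb t a s' r)
  have hterm_int : ∀ a s' (r : M.rewards), Integrable ((fun ω => g t ω a s' r) * Z a s' r) P :=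
    fun a s' r => (hZ_int a s' r).bdd_mul
      ((hg a s' r r.2).mono (ℱ.le t) le_rfl).aestronglyMeasurable
      (.of_forall fun ω => hgC ω a s' r r.2)
  have hterm : ∀ a s' (r : M.rewards), P[(fun ω => g t ω a s' r) * Z a s' r | ℱ t] =ᵐ[P] 0 := by
    intro a s' r
    filter_upwards [condExp_stronglyMeasurable_mul_of_bound (ℱ.le t)
      (hg a s' r r.2).stronglyMeasurable (hZ_int a s' r) C (.of_forall fun ω => hgC ω a s' r r.2),
      hexp.condExp_indicator_sub_transitionProb t a s' r] with ω hmul hzero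
    rw [hmul, Pi.mul_apply, hzero, Pi.zero_apply, mul_zero]
  have hsum : transitionNoise M opts St Ot At Rt g t
      = ∑ z : A × S × M.rewards, (fun ω => g t ω z.1 z.2.1 z.2.2) * Z z.1 z.2.1 z.2.2 := by
    ext ω
    simp only [transitionNoise, Finset.sum_apply, Fintype.sum_prod_type, Pi.mul_apply, hZ,
      Pi.sub_apply]
  rw [hsum]
  filter_upwards [condExp_finsetSum (s := Finset.univ)
    (fun (z : A × S × M.rewards) _ => hterm_int z.1 z.2.1 z.2.2) (ℱ t),
    ae_all_iff.2 fun z : A × S × M.rewards => hterm z.1 z.2.1 z.2.2] with ω hω hzero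
  rw [hω, Finset.sum_apply]
  exact Finset.sum_eq_zero fun z _ => hzero z

-- The noise of the constant `1` is minus the indicator of an impossible reward, and has mean zero.
theorem ae_reward_mem (hexp : IsExperience P ℱ M opts St Ot At Rt) (t : ℕ) :
    ∀ᵐ ω ∂P, Rt (t + 1) ω ∈ M.rewards := by
  set W := transitionNoise M opts St Ot At Rt (fun _ _ _ _ _ => 1) t with hW
  have hmem : ∀ ω, Rt (t + 1) ω ∈ M.rewards → W ω = 0 := fun ω hR => by
    rw [hW, transitionNoise_of_reward_mem hR, stepExpectation_const, sub_self]
  have hnotMem : ∀ ω, Rt (t + 1) ω ∉ M.rewards → W ω = -1 := fun ω hR => by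
    rw [hW, transitionNoise_of_reward_notMem hR, stepExpectation_const]
  have hnonneg : 0 ≤ -W := fun ω => by
    by_cases hR : Rt (t + 1) ω ∈ M.rewards
    · simp [hmem ω hR]
    · simp [hnotMem ω hR]
  have hint : Integrable W P := by
    refine integrable_finsetSum _ fun a _ => integrable_finsetSum _ fun s' _ =>
      integrable_finsetSum _ fun r _ => Integrable.const_mul ?_ 1
    exact (hexp.integrable_transitionIndicator t a s' r).sub
      (hexp.integrable_transitionProb t a s' r)
  have hmean : ∫ ω, W ω ∂P = 0 := by
    rw [← integral_condExp (ℱ.le t), integral_congr_ae (hexp.condExp_transitionNoise (C := 1)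
      (fun _ _ _ _ => measurable_const) fun _ _ _ _ _ => abs_one.le)]
    exact integral_zero Ω ℝ
  have hzero : -W =ᵐ[P] 0 := (integral_eq_zero_iff_of_nonneg hnonneg hint.neg).1
    ((integral_neg W).trans (neg_eq_zero.2 hmean))
  filter_upwards [hzero] with ω hω
  by_contra hR
  simp [hnotMem ω hR] at hω

theorem isBoundedMartingaleDifference_transitionNoise
    (hexp : IsExperience P ℱ M opts St Ot At Rt)
    (hg : ∀ t a s', ∀ r ∈ M.rewards, Measurable[ℱ t] fun ω => g t ω a s' r)
    (hgC : ∀ t ω a s', ∀ r ∈ M.rewards, |g t ω a s' r| ≤ C) :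
    IsBoundedMartingaleDifference P ℱ (C + C) (transitionNoise M opts St Ot At Rt g) where
  measurable t := by
    refine Finset.measurable_fun_sum _ fun a _ => Finset.measurable_fun_sum _ fun s' _ =>
      Finset.measurable_fun_sum _ fun r _ => ?_
    exact ((hg t a s' r r.2).mono (ℱ.mono t.le_succ) le_rfl).mul
      ((hexp.measurable_transitionIndicator t a s' r).sub
        ((hexp.measurable_transitionProb t a s' r).mono (ℱ.mono t.le_succ) le_rfl))
  ae_abs_le t := by
    filter_upwards [hexp.ae_reward_mem t] with ω hR
    rw [transitionNoise_of_reward_mem hR]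
    refine (abs_sub _ _).trans (add_le_add (hgC t ω _ _ _ hR) ?_)
    exact (abs_stepExpectation_le M _ _ (hgC t ω)).trans_eq (stepExpectation_const M _ _ C)
  condExp_eq_zero t := hexp.condExp_transitionNoise (hg t) (hgC t)

end IsExperience

end TransitionNoise

section TemporalDifference

/-- The temporal difference error of the values `v` for the option `o` on a step from `s` to `s'` in
which the signal `c` is received. -/
def tdError {S A : Type*} [Fintype A] (o : MDPOption S A) (v : S → ℝ) (s s' : S) (c : ℝ) : ℝ :=
  c + (1 - o.termination s') * v s' - v s

theorem abs_tdError_le {S A : Type*} [Fintype A] (o : MDPOption S A) (v : S → ℝ) (s s' : S)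
    (c : ℝ) : |tdError o v s s' c| ≤ |c| + |v s'| + |v s| := by
  have hcontinue : |(1 - o.termination s') * v s'| ≤ |v s'| := by
    rw [abs_mul, abs_of_nonneg (sub_nonneg.2 (o.termination_le_one s'))]
    exact mul_le_of_le_one_left (abs_nonneg _) (sub_le_self 1 (o.termination_nonneg s'))
  exact (abs_sub _ _).trans (add_le_add_left ((abs_add_le _ _).trans
    (add_le_add_right hcontinue _)) _)

variable {S A O : Type*} [Fintype S] [Fintype A] {M : FiniteMDP S A}

/-- The values `m` solve the Bellman equation for the total, up to the termination of `o`, of the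
signal `G s' r` received on arrival in the state `s'` with the reward `r`. -/
def IsBellmanSolution (M : FiniteMDP S A) (o : MDPOption S A) (G : S → ℝ → ℝ) (m : S → ℝ) : Prop :=
  ∀ s, m s = stepExpectation M o s fun _ s' r => G s' r + (1 - o.termination s') * m s'

/-- The error of the values `v` as estimates of `m`, divided by expected durations. -/
noncomputable def weightedError (M : FiniteMDP S A) (o : MDPOption S A) (m v : S → ℝ) (s : S) : ℝ :=
  (v s - m s) / durationModel M o s

section

variable {o : MDPOption S A} {G : S → ℝ → ℝ} {m : S → ℝ}
  (hfinite : ∀ s, FiniteExpectedDuration M o s)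

include hfinite

theorem eq_add_durationModel_mul_weightedError (m v : S → ℝ) (s : S) :
    v s = m s + durationModel M o s * weightedError M o m v s := by
  rw [weightedError, mul_div_cancel₀ _ (durationModel_pos hfinite s).ne', add_sub_cancel]

theorem abs_le_mul_max_one_norm_weightedError (m v : S → ℝ) (s : S) :
    |v s| ≤ (|m s| + durationModel M o s) * max 1 ‖weightedError M o m v‖ := by
  have hpos := durationModel_pos hfinite s
  rw [eq_add_durationModel_mul_weightedError hfinite m v s, add_mul]
  refine (abs_add_le _ _).trans (add_le_add ?_ ?_)
  · exact le_mul_of_one_le_right (abs_nonneg _) (le_max_left _ _)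
  · rw [abs_mul, abs_of_pos hpos]
    exact mul_le_mul_of_nonneg_left
      ((norm_le_pi_norm (weightedError M o m v) s).trans (le_max_right _ _)) hpos.le

theorem stepExpectation_tdError (hm : IsBellmanSolution M o G m) (v : S → ℝ) (s : S) :
    stepExpectation M o s (fun _ s' r => tdError o v s s' (G s' r)) = durationModel M o s *
      (weightedContinuation M o (weightedError M o m v) s - weightedError M o m v s) := by
  have hsplit : ∀ s' r, tdError o v s s' (G s' r) = (G s' r + (1 - o.termination s') * m s') +
      ((1 - o.termination s') * (durationModel M o s' * weightedError M o m v s') + -v s) := by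
    intro s' r
    rw [tdError, eq_add_durationModel_mul_weightedError hfinite m v s']
    ring
  simp only [hsplit]
  rw [stepExpectation_add M o s fun _ s' r => G s' r + (1 - o.termination s') * m s', ← hm s,
    stepExpectation_add M o s fun _ s' _ =>
      (1 - o.termination s') * (durationModel M o s' * weightedError M o m v s'),
    stepExpectation_const, mul_sub, weightedContinuation,
    mul_div_cancel₀ _ (durationModel_pos hfinite s).ne', weightedError,
    mul_div_cancel₀ _ (durationModel_pos hfinite s).ne']
  ring

end

/-- The importance sampled temporal difference error of the option `o` when `o'` is executed, in the
weighted coordinates and relative to the size of the weighted error. -/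
noncomputable def normalizedTDError (M : FiniteMDP S A) (opts : O → MDPOption S A) (o o' : O)
    (m v : S → ℝ) (s : S) (a : A) (s' : S) (c : ℝ) : ℝ :=
  importanceRatio opts a s o o' * tdError (opts o) v s s' c /
    (durationModel M (opts o) s * max 1 ‖weightedError M (opts o) m v‖)

theorem max_one_mul_normalizedTDError (opts : O → MDPOption S A) (o o' : O) (m v : S → ℝ) (s : S)
    (a : A) (s' : S) (c : ℝ) :
    max 1 ‖weightedError M (opts o) m v‖ * normalizedTDError M opts o o' m v s a s' c
      = importanceRatio opts a s o o' *
          (tdError (opts o) v s s' c / durationModel M (opts o) s) := by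
  have hpos : 0 < max 1 ‖weightedError M (opts o) m v‖ := one_pos.trans_le (le_max_left _ _)
  rw [normalizedTDError, ← div_div, mul_div_cancel₀ _ hpos.ne', mul_div_assoc]

variable {opts : O → MDPOption S A} {o : O} (hfinite : ∀ s, FiniteExpectedDuration M (opts o) s)

include hfinite

theorem exists_abs_normalizedTDError_le [Finite O] (G : S → ℝ → ℝ) (m : S → ℝ) (s : S) :
    ∃ C, ∀ o' v a s', ∀ r ∈ M.rewards,
      |normalizedTDError M opts o o' m v s a s' (G s' r)| ≤ C := by
  set w := durationModel M (opts o)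
  obtain ⟨C, hC⟩ := Finite.exists_le fun z : O × A × S × M.rewards =>
    |importanceRatio opts z.2.1 s o z.1| *
      (|G z.2.2.1 z.2.2.2| + (|m z.2.2.1| + w z.2.2.1) + (|m s| + w s))
  refine ⟨C, fun o' v a s' r hr => le_trans ?_ (hC (o', a, s', ⟨r, hr⟩))⟩
  set B := max 1 ‖weightedError M (opts o) m v‖
  have hB : 1 ≤ B := le_max_left _ _
  have hw : 1 ≤ w s := one_le_durationModel hfinite s
  have hwB : B ≤ w s * B := le_mul_of_one_le_left (zero_le_one.trans hB) hw
  have hwB_pos : 0 < w s * B := (one_pos.trans_le hB).trans_le hwB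
  have htd : |tdError (opts o) v s s' (G s' r)|
      ≤ (|G s' r| + (|m s'| + w s') + (|m s| + w s)) * B := by
    refine (abs_tdError_le _ _ _ _ _).trans ?_
    rw [add_mul, add_mul]
    gcongr
    · exact le_mul_of_one_le_right (abs_nonneg _) hB
    · exact abs_le_mul_max_one_norm_weightedError hfinite m v s'
    · exact abs_le_mul_max_one_norm_weightedError hfinite m v s
  rw [normalizedTDError, abs_div, abs_mul, abs_of_pos hwB_pos, div_le_iff₀ hwB_pos, mul_assoc]
  refine mul_le_mul_of_nonneg_left (htd.trans (mul_le_mul_of_nonneg_left hwB ?_)) (abs_nonneg _)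
  have hpos := fun x => (durationModel_pos hfinite x).le
  have := hpos s
  have := hpos s'
  positivity

theorem max_one_mul_stepExpectation_normalizedTDError {G : S → ℝ → ℝ} {m : S → ℝ}
    (hm : IsBellmanSolution M (opts o) G m) {o' : O} {s : S}
    (hcover : ∀ a, (opts o').policy a s = 0 → (opts o).policy a s = 0) (v : S → ℝ) :
    max 1 ‖weightedError M (opts o) m v‖ * stepExpectation M (opts o') s
        (fun a s' r => normalizedTDError M opts o o' m v s a s' (G s' r))
      = weightedContinuation M (opts o) (weightedError M (opts o) m v) s
        - weightedError M (opts o) m v s := by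
  rw [← stepExpectation_const_mul]
  simp only [max_one_mul_normalizedTDError]
  rw [stepExpectation_importanceRatio_mul M s opts o o' hcover fun _ s' r =>
    tdError (opts o) v s s' (G s' r) / durationModel M (opts o) s]
  simp only [div_eq_inv_mul]
  rw [stepExpectation_const_mul, stepExpectation_tdError hfinite hm,
    inv_mul_cancel_left₀ (durationModel_pos hfinite s).ne']

end TemporalDifference

section Convergence

variable {S A O Ω : Type*} [Fintype S] [Fintype A]
  {M : FiniteMDP S A} {opts : O → MDPOption S A} {G : S → ℝ → ℝ} {m : S → ℝ}
  {St : ℕ → Ω → S} {Ot : ℕ → Ω → O} {At : ℕ → Ω → A} {Rt : ℕ → Ω → ℝ}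

theorem weightedError_update {o : O} (hfinite : ∀ s, FiniteExpectedDuration M (opts o) s)
    (hm : IsBellmanSolution M (opts o) G m) {t : ℕ} {ω : Ω} {s : S} {a : ℝ} {v v' : S → ℝ}
    (hR : Rt (t + 1) ω ∈ M.rewards)
    (hupdate : a ≠ 0 → s = St t ω ∧
      ∀ b, (opts (Ot t ω)).policy b (St t ω) = 0 → (opts o).policy b (St t ω) = 0)
    (hstep : v' s = v s + a * importanceRatio opts (At t ω) s o (Ot t ω) *
      tdError (opts o) v s (St (t + 1) ω) (G (St (t + 1) ω) (Rt (t + 1) ω))) :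
    weightedError M (opts o) m v' s = weightedError M (opts o) m v s + a *
      (weightedContinuation M (opts o) (weightedError M (opts o) m v) s
        - weightedError M (opts o) m v s + max 1 ‖weightedError M (opts o) m v‖ *
          transitionNoise M opts St Ot At Rt (fun t ω b s' r =>
            normalizedTDError M opts o (Ot t ω) m v s b s' (G s' r)) t ω) := by
  rcases eq_or_ne a 0 with rfl | ha
  · simp [weightedError, hstep]
  · obtain ⟨rfl, hcover⟩ := hupdate ha
    rw [transitionNoise_of_reward_mem hR, mul_sub, max_one_mul_normalizedTDError,
      max_one_mul_stepExpectation_normalizedTDError hfinite hm hcover, add_sub_cancel,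
      weightedError, hstep, weightedError]
    ring

namespace IsExperience

variable [MeasurableSpace Ω] {P : Measure Ω}
  {ℱ : Filtration ℕ (inferInstance : MeasurableSpace Ω)}

theorem measurable_normalizedTDError [Countable O] (hexp : IsExperience P ℱ M opts St Ot At Rt)
    {t : ℕ} {X : Ω → S → ℝ} (hX : ∀ s, Measurable[ℱ t] fun ω => X ω s)
    (o : O) (m : S → ℝ) (s : S) (a : A) (s' : S) (c : ℝ) :
    Measurable[ℱ t] fun ω => normalizedTDError M opts o (Ot t ω) m (X ω) s a s' c := by
  refine Measurable.div (Measurable.mul ?_ ?_) (Measurable.const_mul (measurable_const.max ?_) _)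
  · exact measurable_comp_of_countable (hexp.measurable_option t)
      (F := fun o' _ => importanceRatio opts a s o o') fun _ => measurable_const
  · exact (((hX s').const_mul _).const_add _).sub (hX s)
  · refine measurable_norm.comp (@measurable_pi_lambda _ _ _ (ℱ t) _ _ fun y => ?_)
    exact ((hX y).sub_const _).div_const _

variable [IsFiniteMeasure P] [Finite O]

theorem ae_tendsto_of_isBellmanSolution (hexp : IsExperience P ℱ M opts St Ot At Rt) {o : O}
    (hfinite : ∀ s, FiniteExpectedDuration M (opts o) s) (hm : IsBellmanSolution M (opts o) G m)
    {α : S → ℕ → Ω → ℝ} (hα : ∀ s, IsRobbinsMonro P ℱ (α s))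
    (hupdate : ∀ t s, ∀ᵐ ω ∂P, α s t ω ≠ 0 → s = St t ω ∧
      ∀ a, (opts (Ot t ω)).policy a (St t ω) = 0 → (opts o).policy a (St t ω) = 0)
    {X : ℕ → Ω → S → ℝ} (hX : ∀ t s, Measurable[ℱ t] fun ω => X t ω s)
    (hstep : ∀ t s, ∀ᵐ ω ∂P, X (t + 1) ω s = X t ω s +
      α s t ω * importanceRatio opts (At t ω) s o (Ot t ω) *
        tdError (opts o) (X t ω) s (St (t + 1) ω) (G (St (t + 1) ω) (Rt (t + 1) ω))) :
    ∀ᵐ ω ∂P, ∀ s, Tendsto (fun t => X t ω s) atTop (𝓝 (m s)) := by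
  obtain ⟨γ, hγ, hcontract⟩ := exists_durationModel_sub_one_le M (opts o)
  choose C hC using exists_abs_normalizedTDError_le hfinite G m
  have hnoise := fun s => hexp.isBoundedMartingaleDifference_transitionNoise
    (g := fun t ω a s' r => normalizedTDError M opts o (Ot t ω) m (X t ω) s a s' (G s' r))
    (fun t a s' r _ => hexp.measurable_normalizedTDError (hX t) o m s a s' (G s' r))
    (fun t ω a s' r hr => hC s (Ot t ω) (X t ω) a s' r hr)
  have herror : ∀ t, Measurable[ℱ t] fun ω => weightedError M (opts o) m (X t ω) := fun t =>
    @measurable_pi_lambda _ _ _ (ℱ t) _ _ fun s => ((hX t s).sub_const _).div_const _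
  have hlim := ae_tendsto_zero_of_contracting_targets hγ herror hα hnoise
    (.of_forall fun ω t s => abs_weightedContinuation_le hfinite hcontract
      (weightedError M (opts o) m (X t ω)) s)
    (by
      filter_upwards [ae_all_iff.2 fun t => ae_all_iff.2 (hupdate t),
        ae_all_iff.2 fun t => ae_all_iff.2 (hstep t), ae_all_iff.2 hexp.ae_reward_mem]
        with ω hupdate hstep hR t s
      exact weightedError_update hfinite hm (hR t) (hupdate t s) (hstep t s))
  filter_upwards [hlim] with ω hω s
  simp only [fun t => eq_add_durationModel_mul_weightedError hfinite m (X t ω) s]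
  simpa using ((tendsto_pi_nhds.1 hω s).const_mul (durationModel M (opts o) s)).const_add (m s)

end IsExperience

end Convergence

section Estimates

variable {S A O : Type*} [Fintype A]

theorem cumulantEstimate_succ (opts : O → MDPOption S A) {α : ℕ → S → O → ℝ} {st : ℕ → S} {t : ℕ}
    {s : S} {o : O} (hα : s ≠ st t → α t s o = 0) (ot : ℕ → O) (act : ℕ → A) (c : ℕ → ℝ)
    (M₀ : S → O → ℝ) :
    cumulantEstimate opts α st ot act c M₀ (t + 1) s o
      = cumulantEstimate opts α st ot act c M₀ t s o
        + α t s o * importanceRatio opts (act t) s o (ot t) *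
          tdError (opts o) (fun s => cumulantEstimate opts α st ot act c M₀ t s o) s (st (t + 1))
            (c (t + 1)) := by
  by_cases hs : s = st t
  · exact if_pos hs
  · rw [hα hs, zero_mul, zero_mul, add_zero]
    exact if_neg hs

open Classical in
theorem dynamicsEstimate_eq_cumulantEstimate (opts : O → MDPOption S A) (α : ℕ → S → O → ℝ)
    (st : ℕ → S) (ot : ℕ → O) (act : ℕ → A) (M₀ : S → S → O → ℝ) (t : ℕ) (x s : S) (o : O) :
    dynamicsEstimate opts α st ot act M₀ t x s o
      = cumulantEstimate opts α st ot act
        (fun t => (opts o).termination (st t) * (if st t = x then 1 else 0)) (M₀ x) t s o := by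
  induction t generalizing s with
  | zero => rfl
  | succ t ih => simp only [dynamicsEstimate, cumulantEstimate, ih]

variable {Ω : Type*} [Fintype S] [MeasurableSpace Ω] {P : Measure Ω}
  {ℱ : Filtration ℕ (inferInstance : MeasurableSpace Ω)}
  {M : FiniteMDP S A} {opts : O → MDPOption S A}
  {St : ℕ → Ω → S} {Ot : ℕ → Ω → O} {At : ℕ → Ω → A} {Rt : ℕ → Ω → ℝ}

namespace IsExperience

theorem measurable_cumulantEstimate [Countable O] (hexp : IsExperience P ℱ M opts St Ot At Rt)
    {α : ℕ → S → O → Ω → ℝ} {o : O} (hα : ∀ t s, Measurable[ℱ t] (α t s o))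
    {c : ℕ → Ω → ℝ} (hc : ∀ t, Measurable[ℱ (t + 1)] (c (t + 1))) (M₀ : S → O → ℝ)
    (t : ℕ) (s : S) :
    Measurable[ℱ t] fun ω => cumulantEstimate opts (fun t s o => α t s o ω) (fun t => St t ω)
      (fun t => Ot t ω) (fun t => At t ω) (fun t => c t ω) M₀ t s o := by
  induction t generalizing s with
  | zero => exact measurable_const
  | succ t ih =>
    have hle := ℱ.mono t.le_succ
    have hstate : MeasurableSet[ℱ (t + 1)] {ω | s = St t ω} :=
      hle _ (hexp.measurable_state t (show MeasurableSet[⊤] {x | s = x} from trivial))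
    have hratio : Measurable[ℱ (t + 1)] fun ω => importanceRatio opts (At t ω) s o (Ot t ω) :=
      measurable_comp_of_countable (hexp.measurable_action t)
        (F := fun a ω => importanceRatio opts a s o (Ot t ω)) fun a =>
          measurable_comp_of_countable ((hexp.measurable_option t).mono hle le_rfl)
            (F := fun o' _ => importanceRatio opts a s o o') fun _ => measurable_const
    have hprev := fun s => (ih s).mono hle le_rfl
    have hcontinue := measurable_comp_of_countable (hexp.measurable_state (t + 1))
      fun x => (hprev x).const_mul (1 - (opts o).termination x)
    exact Measurable.ite hstate ((hprev s).add ((((hα t s).mono hle le_rfl).mul hratio).mul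
      (((hc t).add hcontinue).sub (hprev s)))) (hprev s)

theorem ae_tendsto_cumulantEstimate [IsFiniteMeasure P] [Finite O]
    (hexp : IsExperience P ℱ M opts St Ot At Rt) {o : O}
    (hfinite : ∀ s, FiniteExpectedDuration M (opts o) s) {α : ℕ → S → O → Ω → ℝ}
    (hα : ∀ s, IsRobbinsMonro P ℱ fun t => α t s o)
    (hα_zero : ∀ t s, ∀ᵐ ω ∂P, s ≠ St t ω → α t s o ω = 0)
    (hcover : ∀ t, ∀ᵐ ω ∂P, α t (St t ω) o ω ≠ 0 →
      ∀ a, (opts (Ot t ω)).policy a (St t ω) = 0 → (opts o).policy a (St t ω) = 0)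
    {G : S → ℝ → ℝ} (hG : ∀ s, Measurable (G s)) {m : S → ℝ}
    (hm : IsBellmanSolution M (opts o) G m) (M₀ : S → O → ℝ) :
    ∀ᵐ ω ∂P, ∀ s, Tendsto (fun t => cumulantEstimate opts (fun t s o => α t s o ω)
      (fun t => St t ω) (fun t => Ot t ω) (fun t => At t ω) (fun t => G (St t ω) (Rt t ω)) M₀ t s o)
      atTop (𝓝 (m s)) := by
  have hsignal : ∀ t, Measurable[ℱ (t + 1)] fun ω => G (St (t + 1) ω) (Rt (t + 1) ω) := fun t =>
    measurable_comp_of_countable (hexp.measurable_state (t + 1))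
      (F := fun s ω => G s (Rt (t + 1) ω)) fun s => (hG s).comp (hexp.measurable_reward t)
  refine hexp.ae_tendsto_of_isBellmanSolution hfinite hm hα (fun t s => ?_)
    (fun t s => hexp.measurable_cumulantEstimate (c := fun t ω => G (St t ω) (Rt t ω))
      (fun t s => (hα s).measurable t) hsignal M₀ t s) fun t s => ?_
  · filter_upwards [hα_zero t s, hcover t] with ω hzero hcover hne
    obtain rfl : s = St t ω := not_imp_comm.1 hzero hne
    exact ⟨rfl, hcover hne⟩
  · filter_upwards [hα_zero t s] with ω hzero
    exact cumulantEstimate_succ opts hzero _ _ _ M₀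

end IsExperience

end Estimates

theorem theorem5 {S A O Ω : Type*} [Fintype S] [Fintype A] [Fintype O] [MeasurableSpace Ω]
    (P : Measure Ω) [IsProbabilityMeasure P]
    (ℱ : Filtration ℕ (inferInstance : MeasurableSpace Ω))
    (M : FiniteMDP S A) (opts : O → MDPOption S A)
    -- the expected execution time of every option from every state is finite
    (hfinite : ∀ o s, FiniteExpectedDuration M (opts o) s)
    (St : ℕ → Ω → S) (Ot : ℕ → Ω → O) (At : ℕ → Ω → A) (Rt : ℕ → Ω → ℝ)
    (hexp : IsExperience P ℱ M opts St Ot At Rt)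
    -- step sizes, one for each state-option pair
    (α : ℕ → S → O → Ω → ℝ)
    (hα_adapted : ∀ t s o, Measurable[ℱ t] (α t s o))
    (hα_mem : ∀ t s o, ∀ᵐ ω ∂P, α t s o ω ∈ Set.Icc (0 : ℝ) 1)
    (hα_sum : ∀ s o, ∀ᵐ ω ∂P,
      Tendsto (fun n => ∑ t ∈ Finset.range n, α t s o ω) atTop atTop)
    (hα_sq : ∀ s o, ∀ᵐ ω ∂P, Summable fun t => α t s o ω ^ 2)
    (hα_zero : ∀ t s o, ∀ᵐ ω ∂P, s ≠ St t ω → α t s o ω = 0)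
    -- coverage: the executed option may take every action that an updated option may take
    (hcover : ∀ t o, ∀ᵐ ω ∂P, α t (St t ω) o ω ≠ 0 →
      ∀ a, (opts (Ot t ω)).policy a (St t ω) = 0 → (opts o).policy a (St t ω) = 0)
    -- arbitrary initial estimates
    (Mp₀ : S → S → O → ℝ) (Mr₀ Ml₀ : S → O → ℝ) :
    ∀ᵐ ω ∂P, ∀ s o,
      (∀ x, Tendsto
        (fun t => dynamicsEstimate opts (fun t s o => α t s o ω) (fun t => St t ω)
          (fun t => Ot t ω) (fun t => At t ω) Mp₀ t x s o)
        atTop (𝓝 (dynamicsModel M (opts o) x s))) ∧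
      Tendsto
        (fun t => rewardEstimate opts (fun t s o => α t s o ω) (fun t => St t ω)
          (fun t => Ot t ω) (fun t => At t ω) (fun t => Rt t ω) Mr₀ t s o)
        atTop (𝓝 (rewardModel M (opts o) s)) ∧
      Tendsto
        (fun t => durationEstimate opts (fun t s o => α t s o ω) (fun t => St t ω)
          (fun t => Ot t ω) (fun t => At t ω) Ml₀ t s o)
        atTop (𝓝 (durationModel M (opts o) s)) := by
  classical
  have hconv (o : O) {G : S → ℝ → ℝ} := hexp.ae_tendsto_cumulantEstimate (hfinite o) (G := G)
    (fun s => ⟨fun t => hα_adapted t s o, fun t => hα_mem t s o, hα_sum s o, hα_sq s o⟩)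
    (fun t s => hα_zero t s o) (fun t => hcover t o)
  have hdyn := fun o x => hconv o
    (G := fun s' _ => (opts o).termination s' * (if s' = x then 1 else 0))
    (fun _ => measurable_const) (dynamicsModel_eq_stepExpectation (hfinite o) x) (Mp₀ x)
  have hrew := fun o => hconv o (G := fun _ r => r) (fun _ => measurable_id)
    (rewardModel_eq_stepExpectation (hfinite o)) Mr₀
  have hdur := fun o => hconv o (G := fun _ _ => 1) (fun _ => measurable_const)
    (durationModel_eq_stepExpectation (hfinite o)) Ml₀
  filter_upwards [ae_all_iff.2 fun o => ae_all_iff.2 (hdyn o), ae_all_iff.2 hrew,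
    ae_all_iff.2 hdur] with ω hdyn hrew hdur s o
  refine ⟨fun x => ?_, hrew o s, hdur o s⟩
  simpa only [dynamicsEstimate_eq_cumulantEstimate] using hdyn o x s
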